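/- For a topological space $X$ whose total rational singular homology is finite-dimensional, let $\chi(X)=\sum_k(-1)^k\dim H_k(X;\mathbf{Q})$. For a finite group $G$ let $Com(G,m)$ be the set of $m$-tuples of mutually commuting elements of $G$, and for an action of $G$ on $X$ put $$\chi_m(X,G)=\frac{1}{|G|}\sum_{(g_1,\dots,g_m)\in Com(G,m)}\chi\big(X^{(g_1,\dots,g_m)}\big),$$ where $X^{(g_1,\dots,g_m)}$ is the simultaneous fixed point set of $g_1,\dots,g_m$. For permutations $\pi_1,\dots,\pi_m\in S_n$ let $\#(\pi_1,\dots,\pi_m)$ be the number of connected components of the graph on $\{1,\dots,n\}$ in which every vertex $a$ is joined to $\pi_1(a),\dots,\pi_m(a)$. Theorem. Let $M$ be a manifold (Hausdorff, second countable, finite-dimensional, possibly with boundary or corners) whose total rational homology is finite-dimensional, let $\chi=\chi(M)$, and let $m\ge 1$. Let $S_n$ act on $M^n$ by permuting the factors. Then all the Euler characteristics that occur in $\chi_m(M^n,S_n)$ are defined, and in the ring of formal power series $\mathbf{Q}[[u]]$ $$\sum_{n=0}^\infty \chi_m(M^n,S_n)\,u^n=\sum_{n=0}^\infty\frac{u^n}{n!}\sum_{(\pi_1,\dots,\pi_m)\in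 Com(S_n,m)}\chi^{\#(\pi_1,\dots,\pi_m)}$$ $$=\left(\sum_{n=0}^\infty |Com(S_n,m)|\,\frac{u^n}{n!}\right)^{\chi}$$ $$=\prod_{i_1,\dots,i_{m-1}=1}^\infty\left(1-u^{i_1\cdots i_{m-1}}\right)^{-\chi\, i_1^{m-2}i_2^{m-3}\cdots i_{m-2}},$$ where the infinite product converges coefficientwise. For $m=1$ the product has the single factor $(1-u)^{-\chi}$. -/

import Mathlib

open scoped Manifold PowerSeries

universe u

noncomputable section

/-! ### The Euler characteristic of a topological space -/

/-- The singular chain complex of `X` with rational coefficients. -/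
def rationalSingularChains (X : Type u) [TopologicalSpace X] :
    ChainComplex (ModuleCat.{u} ℚ) ℕ :=
  ((AlgebraicTopology.singularChainComplexFunctor (ModuleCat.{u} ℚ)).obj
    (ModuleCat.of ℚ (ULift.{u} ℚ))).obj (TopCat.of X)

/-- The total rational singular homology of `X` is finite-dimensional,
i.e. the Euler characteristic of `X` is defined. -/
def HasFiniteRationalHomology (X : Type u) [TopologicalSpace X] : Prop :=
  (∀ k : ℕ, FiniteDimensional ℚ ((rationalSingularChains X).homology k)) ∧
    ∃ N : ℕ, ∀ k : ℕ, N ≤ k → Subsingleton ((rationalSingularChains X).homology k)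

/-- The Euler characteristic `∑ₖ (-1)ᵏ dim H_k(X; ℚ)`
(a meaningful value only when `HasFiniteRationalHomology X`). -/
def eulerCharacteristic (X : Type u) [TopologicalSpace X] : ℤ :=
  (rationalSingularChains X).homologyEulerChar

/-! ### Commuting tuples and orbifold Euler characteristics -/

open Classical in
/-- `Com(G, m)`: the `m`-tuples of mutually commuting elements of the finite group `G`. -/
def commutingTuples (G : Type*) [Group G] [Fintype G] (m : ℕ) : Finset (Fin m → G) :=
  Finset.univ.filter fun g => ∀ i j, Commute (g i) (g j)

/-- The simultaneous fixed point set `X^{(g₁, …, g_m)}`. -/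
def simultaneousFixedPoints {G : Type*} [Group G] (X : Type u) [MulAction G X] {m : ℕ}
    (g : Fin m → G) : Set X :=
  {x | ∀ j, g j • x = x}

/-- The `m`-th orbifold Euler characteristic `χ_m(X, G)`. -/
def orbifoldEulerCharacteristic (m : ℕ) (X : Type u) [TopologicalSpace X]
    (G : Type*) [Group G] [Fintype G] [MulAction G X] : ℚ :=
  (1 / (Fintype.card G : ℚ)) *
    ∑ g ∈ commutingTuples G m, (eulerCharacteristic (simultaneousFixedPoints X g) : ℚ)

/-- The permutation action of `S_n` on the `n`-fold product `M^n`: `(π • x) i = x (π⁻¹ i)`. -/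
instance permProductAction (M : Type u) (n : ℕ) :
    MulAction (Equiv.Perm (Fin n)) (Fin n → M) :=
  arrowAction

/-- The graph on the vertices `1, …, n` which joins each vertex `a` to `π₁ a, …, π_m a`. -/
def tupleGraph {n m : ℕ} (π : Fin m → Equiv.Perm (Fin n)) : SimpleGraph (Fin n) :=
  SimpleGraph.fromRel fun a b => ∃ j, π j a = b

/-- `#(π₁, …, π_m)`: the number of connected components of this graph. -/
def numComponents {n m : ℕ} (π : Fin m → Equiv.Perm (Fin n)) : ℕ :=
  Nat.card (tupleGraph π).ConnectedComponent

/-! ### Formal power series -/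

/-- The power `f ^ k` of a formal power series with an integer exponent
(used for series with nonzero constant coefficient, where `f⁻¹` is the inverse of `f`). -/
def seriesZPow (f : ℚ⟦X⟧) : ℤ → ℚ⟦X⟧
  | Int.ofNat k => f ^ k
  | Int.negSucc k => f⁻¹ ^ (k + 1)

/-- The infinite product `∏ f i` converges to `g` as a formal power series: every coefficient of
the finite subproducts is eventually constant, equal to the corresponding coefficient of `g`. -/
def HasFormalProd {ι : Type*} (f : ι → ℚ⟦X⟧) (g : ℚ⟦X⟧) : Prop :=
  ∀ d : ℕ, ∀ᶠ s : Finset ι in Filter.atTop,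
    PowerSeries.coeff d (∏ i ∈ s, f i) = PowerSeries.coeff d g

/-- The generating function `∑ₙ χ_m(M^n, S_n) uⁿ`. -/
def orbifoldGeneratingFunction (M : Type u) [TopologicalSpace M] (m : ℕ) : ℚ⟦X⟧ :=
  PowerSeries.mk fun n => orbifoldEulerCharacteristic m (Fin n → M) (Equiv.Perm (Fin n))

end

/-! The theorem joins one topological fact with a count of group actions.

Topology: a point of $M^n$ fixed by all the $\pi_j$ is a function constant on the components of
their graph, so the fixed point set is homeomorphic to $M^{\#(\pi)}$, and by the Künneth formula its
Euler characteristic is $\chi^{\#(\pi)}$. The Künneth formula is needed for dimensions only, and is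
proved for simplicial vector spaces by dimension shifting. A simplicial vector space $A$ splits as
`base A` plus the constant object on `pi₀ A`; `base A` is the quotient of a contractible `path A` by
`loop A`. Tensoring with $B$ over a field keeps exactness and homotopies, so
$H_{n+1}(\mathrm{base}\,A\otimes B)\cong H_n(\mathrm{loop}\,A\otimes B)$, and induction on $n$ gives
`homologyRank_tensor`.

Counting: commuting $m$-tuples in $S_n$ are actions of $\mathbf{Z}^m$ on $n$ points, and components
are orbits. Let $F_x$ be the exponential generating function of actions of $G$ weighted by
$x^{\text{orbits}}$, and $s_k$ the number of subgroups of index $k$. There are $k!\,s_{k+1}$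
transitive actions on $k+1$ points; sorting actions by the orbit of one point gives
$F_x'=x\left(\sum_k s_{k+1}u^k\right)F_x$ (`derivative_orbitSeries`), that is,
$F_x=\exp\left(x\sum_k s_k u^k/k\right)$. Linearity in $x$ of the logarithmic derivative yields
$F_\chi=F_1^\chi$.

For the product, $s_n(\mathbf{Z}^{k+1})=\sum_{d\mid n}d\,s_d(\mathbf{Z}^k)$ makes
$s_n(\mathbf{Z}^k)$ a weighted count of factorizations of $n$, and this is what the logarithmic
derivative of the product produces. All series are compared through $f'=af$
(`coeff_eq_of_derivative_eq`), degree by degree, so convergence of the product comes at the same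
time. -/

noncomputable section

open CategoryTheory Simplicial Opposite AlgebraicTopology TensorProduct

/-! ### Levelwise tensor products of simplicial vector spaces -/

namespace SimplicialModule

universe v

variable {K : Type v} [Field K]

/-- The levelwise tensor product of two simplicial modules. -/
def tensor (A B : SimplicialObject (ModuleCat.{u} K)) : SimplicialObject (ModuleCat.{u} K) where
  obj n := ModuleCat.of K (A.obj n ⊗[K] B.obj n)
  map f := ModuleCat.ofHom (TensorProduct.map (A.map f).hom (B.map f).hom)
  map_id n := by
    ext : 1
    simp [TensorProduct.map_id]
  map_comp f g := by
    ext : 1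
    simp [TensorProduct.map_comp]

/-- The levelwise tensor product with a fixed simplicial module, as a functor. -/
def tensorFunctor (B : SimplicialObject (ModuleCat.{u} K)) :
    SimplicialObject (ModuleCat.{u} K) ⥤ SimplicialObject (ModuleCat.{u} K) where
  obj A := tensor A B
  map f :=
    { app := fun n => ModuleCat.ofHom ((f.app n).hom.rTensor (B.obj n))
      naturality := fun m n g => by
        ext : 1
        apply TensorProduct.ext'
        intro x y
        have h' := LinearMap.congr_fun (congrArg ModuleCat.Hom.hom (f.naturality g)) x
        exact congrArg (· ⊗ₜ[K] (B.map g).hom y) h' }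
  map_id A := by
    ext n : 3
    exact LinearMap.congr_fun (LinearMap.rTensor_id (B.obj n) (A.obj n)) _
  map_comp f g := by
    ext n : 3
    exact LinearMap.congr_fun
      (LinearMap.rTensor_comp (B.obj n) (g.app n).hom (f.app n).hom) _

instance (B : SimplicialObject (ModuleCat.{u} K)) : (tensorFunctor B).Additive where
  map_add {A A' f g} := by
    ext n : 3
    exact LinearMap.congr_fun
      (LinearMap.rTensor_add (B.obj n) (f.app n).hom (g.app n).hom) _

/-- A simplicial homotopy tensored with the constant homotopy of the identity. -/
def homotopyTensor {A A' : SimplicialObject (ModuleCat.{u} K)} {f g : A ⟶ A'}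
    (H : SimplicialObject.Homotopy f g) (B : SimplicialObject (ModuleCat.{u} K)) :
    SimplicialObject.Homotopy ((tensorFunctor B).map f) ((tensorFunctor B).map g) := by
  let R := SimplicialObject.Homotopy.refl (𝟙 B)
  -- Each homotopy identity is a commutative square or triangle; those of `H` and of the constant
  -- homotopy `R` are tensored together.
  have key : ∀ {a b c d : ModuleCat.{u} K} {a' b' c' d' : ModuleCat.{u} K}
      {p : a ⟶ b} {q : b ⟶ c} {p₁ : a ⟶ d} {q₁ : d ⟶ c}
      {p' : a' ⟶ b'} {q' : b' ⟶ c'} {p₁' : a' ⟶ d'} {q₁' : d' ⟶ c'},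
      p ≫ q = p₁ ≫ q₁ → p' ≫ q' = p₁' ≫ q₁' →
      (ModuleCat.ofHom (TensorProduct.map p.hom p'.hom) : ModuleCat.of K (a ⊗[K] a') ⟶ _) ≫
        (ModuleCat.ofHom (TensorProduct.map q.hom q'.hom) : ModuleCat.of K (b ⊗[K] b') ⟶ _) =
      (ModuleCat.ofHom (TensorProduct.map p₁.hom p₁'.hom) : ModuleCat.of K (a ⊗[K] a') ⟶ _) ≫
        (ModuleCat.ofHom (TensorProduct.map q₁.hom q₁'.hom) :
          ModuleCat.of K (d ⊗[K] d') ⟶ ModuleCat.of K (c ⊗[K] c')) := by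
    intro a b c d a' b' c' d' p q p₁ q₁ p' q' p₁' q₁' h h'
    rw [← ModuleCat.ofHom_comp, ← ModuleCat.ofHom_comp, ← TensorProduct.map_comp,
      ← TensorProduct.map_comp, ← ModuleCat.hom_comp, ← ModuleCat.hom_comp, ← ModuleCat.hom_comp,
      ← ModuleCat.hom_comp, h, h']
  have key' : ∀ {a b c : ModuleCat.{u} K} {a' b' c' : ModuleCat.{u} K}
      {p : a ⟶ b} {q : b ⟶ c} {r : a ⟶ c}
      {p' : a' ⟶ b'} {q' : b' ⟶ c'} {r' : a' ⟶ c'},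
      p ≫ q = r → p' ≫ q' = r' →
      (ModuleCat.ofHom (TensorProduct.map p.hom p'.hom) : ModuleCat.of K (a ⊗[K] a') ⟶ _) ≫
        (ModuleCat.ofHom (TensorProduct.map q.hom q'.hom) : ModuleCat.of K (b ⊗[K] b') ⟶ _) =
      (ModuleCat.ofHom (TensorProduct.map r.hom r'.hom) :
        ModuleCat.of K (a ⊗[K] a') ⟶ ModuleCat.of K (c ⊗[K] c')) := by
    intro a b c a' b' c' p q r p' q' r' h h'
    rw [← ModuleCat.ofHom_comp, ← TensorProduct.map_comp,
      ← ModuleCat.hom_comp, ← ModuleCat.hom_comp, h, h']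
  exact
  { h := fun {n} i => ModuleCat.ofHom (TensorProduct.map (H.h i).hom (R.h i).hom)
    h_zero_comp_δ_zero := fun n => key' (H.h_zero_comp_δ_zero n) (R.h_zero_comp_δ_zero n)
    h_last_comp_δ_last := fun n => key' (H.h_last_comp_δ_last n) (R.h_last_comp_δ_last n)
    h_succ_comp_δ_castSucc_of_lt := fun i j hij =>
      key (H.h_succ_comp_δ_castSucc_of_lt i j hij) (R.h_succ_comp_δ_castSucc_of_lt i j hij)
    h_succ_comp_δ_castSucc_succ := fun j =>
      key (H.h_succ_comp_δ_castSucc_succ j) (R.h_succ_comp_δ_castSucc_succ j)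
    h_castSucc_comp_δ_succ_of_lt := fun i j hij =>
      key (H.h_castSucc_comp_δ_succ_of_lt i j hij) (R.h_castSucc_comp_δ_succ_of_lt i j hij)
    h_comp_σ_castSucc_of_le := fun i j hij =>
      key (H.h_comp_σ_castSucc_of_le i j hij) (R.h_comp_σ_castSucc_of_le i j hij)
    h_comp_σ_succ_of_lt := fun i j hij =>
      key (H.h_comp_σ_succ_of_lt i j hij) (R.h_comp_σ_succ_of_lt i j hij) }

/-- A family of submodules of a simplicial module stable under the simplicial operators. -/
structure SimplicialSubmodule (A : SimplicialObject (ModuleCat.{u} K)) where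
  carrier : ∀ n, Submodule K (A.obj n)
  map_mem : ∀ {m n} (f : m ⟶ n), ∀ x ∈ carrier m, (A.map f).hom x ∈ carrier n

namespace SimplicialSubmodule

variable {A : SimplicialObject (ModuleCat.{u} K)}

/-- The simplicial module underlying a simplicial submodule. -/
def toSimplicial (S : SimplicialSubmodule A) : SimplicialObject (ModuleCat.{u} K) where
  obj n := ModuleCat.of K (S.carrier n)
  map {m n} f := ModuleCat.ofHom ((A.map f).hom.restrict (S.map_mem f))
  map_id n := by
    ext x
    simp
  map_comp f g := by
    ext x
    simp

/-- The inclusion of a simplicial submodule. -/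
def ι (S : SimplicialSubmodule A) : S.toSimplicial ⟶ A where
  app n := ModuleCat.ofHom (S.carrier n).subtype
  naturality m n f := by
    ext x
    rfl

/-- A simplicial map with values in a simplicial submodule. -/
def lift {B : SimplicialObject (ModuleCat.{u} K)} (S : SimplicialSubmodule A) (f : B ⟶ A)
    (hf : ∀ n x, (f.app n).hom x ∈ S.carrier n) : B ⟶ S.toSimplicial where
  app n := ModuleCat.ofHom ((f.app n).hom.codRestrict _ (hf n))
  naturality m n g := by
    ext x
    have h := LinearMap.congr_fun (congrArg ModuleCat.Hom.hom (f.naturality g)) x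
    exact Subtype.ext h

end SimplicialSubmodule

/-! ### Cones on simplices and the contractible path object -/

/-- The functor `[n] ↦ [0] ⋆ [n]`. -/
def cone : SimplexCategory ⥤ SimplexCategory where
  obj n := ⦋n.len + 1⦌
  map {m n} f := SimplexCategory.mkHom
    ⟨Fin.cases 0 fun i => (f.toOrderHom i).succ, by
      intro a b hab
      induction a using Fin.cases with
      | zero => simp
      | succ a =>
        induction b using Fin.cases with
        | zero => simp at hab
        | succ b => simpa using f.toOrderHom.monotone (by simpa using hab)⟩
  map_id n := by
    ext i
    induction i using Fin.cases <;> simp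
  map_comp f g := by
    ext i
    induction i using Fin.cases <;> rfl

/-- The inclusion `[n] ⟶ [0] ⋆ [n]`. -/
def coneIncl : 𝟭 SimplexCategory ⟶ cone where
  app n := SimplexCategory.mkHom ⟨Fin.succ, Fin.strictMono_succ.monotone⟩
  naturality m n f := by
    ext i
    rfl

/-- The cone point of `[0] ⋆ [n]`. -/
def coneVertex (n : SimplexCategory) : ⦋0⦌ ⟶ cone.obj n :=
  SimplexCategory.const _ _ (0 : Fin (n.len + 2))

lemma coneVertex_map {m n : SimplexCategory} (f : m ⟶ n) :
    coneVertex m ≫ cone.map f = coneVertex n := by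
  ext i
  rfl

/-- The map `[0] ⋆ [n + 1] ⟶ [0] ⋆ [n]` which sends the first `j + 1` vertices of `[n + 1]`
to the cone point, and is the degeneracy on the remaining ones. -/
def coneCollapse {n : ℕ} (j : Fin (n + 1)) : ⦋n + 2⦌ ⟶ ⦋n + 1⦌ :=
  SimplexCategory.mkHom
    ⟨fun t : Fin (n + 3) => ⟨if (t : ℕ) ≤ j + 1 then 0 else t - 1, by
      have := t.2; split_ifs <;> omega⟩, by
      intro a b hab
      have hab' : (a : ℕ) ≤ b := hab
      rw [Fin.mk_le_mk]
      split_ifs <;> omega⟩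

lemma coneCollapse_apply {n : ℕ} (j : Fin (n + 1)) (t : Fin (n + 3)) :
    ((coneCollapse j).toOrderHom t : ℕ) = if (t : ℕ) ≤ j + 1 then 0 else (t : ℕ) - 1 := rfl

lemma δ_succ_apply {n : ℕ} (i : Fin (n + 2)) (t : Fin (n + 2)) :
    ((SimplexCategory.δ i.succ).toOrderHom t : ℕ) = if (t : ℕ) ≤ i then (t : ℕ) else t + 1 := by
  change (Fin.succAbove i.succ t : ℕ) = _
  simp only [Fin.succAbove, Fin.lt_def, Fin.val_succ, Fin.val_castSucc]
  split_ifs <;> simp_all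

lemma σ_succ_apply {n : ℕ} (i : Fin (n + 1)) (t : Fin (n + 3)) :
    ((SimplexCategory.σ i.succ).toOrderHom t : ℕ) =
      if (t : ℕ) ≤ i + 1 then (t : ℕ) else t - 1 := by
  change (Fin.predAbove i.succ t : ℕ) = _
  simp only [Fin.predAbove, Fin.lt_def, Fin.val_succ, Fin.val_castSucc]
  split_ifs <;> grind [Fin.coe_castPred]

lemma cone_map_δ {n : ℕ} (i : Fin (n + 2)) :
    (cone.map (SimplexCategory.δ i) : ⦋n + 1⦌ ⟶ ⦋n + 2⦌) = SimplexCategory.δ i.succ := by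
  ext t
  refine Eq.trans ?_ (δ_succ_apply i t).symm
  revert t
  refine Fin.cases (n := n + 1) rfl fun t => ?_
  change ((Fin.succAbove i t).succ : ℕ) = if ((t.succ : Fin (n + 2)) : ℕ) ≤ _ then ((t.succ : Fin (n + 2)) : ℕ)
    else _
  simp only [Fin.succAbove, Fin.lt_def, Fin.val_succ, Fin.val_castSucc]
  split_ifs <;> grind

lemma cone_map_σ {n : ℕ} (i : Fin (n + 1)) :
    (cone.map (SimplexCategory.σ i) : ⦋n + 2⦌ ⟶ ⦋n + 1⦌) = SimplexCategory.σ i.succ := by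
  ext t
  refine Eq.trans ?_ (σ_succ_apply i t).symm
  revert t
  refine Fin.cases (n := n + 2) rfl fun t => ?_
  change ((Fin.predAbove i t).succ : ℕ) = if ((t.succ : Fin (n + 3)) : ℕ) ≤ _ then ((t.succ : Fin (n + 3)) : ℕ)
    else _
  simp only [Fin.predAbove, Fin.lt_def, Fin.val_succ, Fin.val_castSucc]
  split_ifs <;> grind [Fin.coe_castPred]

/-- With the six that follow, these are the identities of a simplicial homotopy, stated in the
simplex category before applying $A$. The operators successively collapse $[n]$ onto the cone point,
which joins the identity to the constant map at the cone point. -/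
lemma cone_δ_zero_collapse (n : ℕ) :
    SimplexCategory.δ (0 : Fin (n + 2)).succ ≫ coneCollapse 0 = 𝟙 _ := by
  ext t
  simp only [SimplexCategory.comp_toOrderHom, OrderHom.comp_coe, Function.comp_apply,
    coneCollapse_apply, δ_succ_apply]
  simp
  grind

lemma cone_δ_last_collapse (n : ℕ) :
    SimplexCategory.δ (Fin.last (n + 1)).succ ≫ coneCollapse (Fin.last n) =
      SimplexCategory.const _ ⦋0⦌ 0 ≫ SimplexCategory.const ⦋0⦌ ⦋n + 1⦌ 0 := by
  ext t
  simp only [SimplexCategory.comp_toOrderHom, OrderHom.comp_coe, Function.comp_apply,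
    coneCollapse_apply, δ_succ_apply]
  simp
  grind

lemma cone_δ_castSucc_collapse_succ {n : ℕ} (i : Fin (n + 2)) (j : Fin (n + 1))
    (hij : i ≤ j.castSucc) :
    SimplexCategory.δ i.castSucc.succ ≫ coneCollapse j.succ =
      coneCollapse j ≫ SimplexCategory.δ i.succ := by
  ext t
  simp only [SimplexCategory.comp_toOrderHom, OrderHom.comp_coe, Function.comp_apply,
    coneCollapse_apply, δ_succ_apply, Fin.val_castSucc, Fin.val_succ]
  rw [Fin.le_def, Fin.val_castSucc] at hij
  grind

lemma cone_δ_collapse_succ {n : ℕ} (j : Fin (n + 1)) :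
    SimplexCategory.δ j.castSucc.succ.succ ≫ coneCollapse j.succ =
      SimplexCategory.δ j.castSucc.succ.succ ≫ coneCollapse j.castSucc := by
  ext t
  simp only [SimplexCategory.comp_toOrderHom, OrderHom.comp_coe, Function.comp_apply,
    coneCollapse_apply, δ_succ_apply, Fin.val_castSucc, Fin.val_succ]
  grind

lemma cone_δ_succ_collapse_castSucc {n : ℕ} (i : Fin (n + 2)) (j : Fin (n + 1))
    (hij : j.castSucc < i) :
    SimplexCategory.δ i.succ.succ ≫ coneCollapse j.castSucc =
      coneCollapse j ≫ SimplexCategory.δ i.succ := by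
  ext t
  simp only [SimplexCategory.comp_toOrderHom, OrderHom.comp_coe, Function.comp_apply,
    coneCollapse_apply, δ_succ_apply, Fin.val_castSucc, Fin.val_succ]
  rw [Fin.lt_def, Fin.val_castSucc] at hij
  grind

lemma cone_σ_castSucc_collapse {n : ℕ} (i j : Fin (n + 1)) (hij : i ≤ j) :
    SimplexCategory.σ i.castSucc.succ ≫ coneCollapse j =
      coneCollapse j.succ ≫ SimplexCategory.σ i.succ := by
  ext t
  simp only [SimplexCategory.comp_toOrderHom, OrderHom.comp_coe, Function.comp_apply,
    coneCollapse_apply, σ_succ_apply, Fin.val_castSucc, Fin.val_succ]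
  rw [Fin.le_def] at hij
  grind

lemma cone_σ_succ_collapse {n : ℕ} (i j : Fin (n + 1)) (hij : j ≤ i) :
    SimplexCategory.σ i.succ.succ ≫ coneCollapse j =
      coneCollapse j.castSucc ≫ SimplexCategory.σ i.succ := by
  ext t
  simp only [SimplexCategory.comp_toOrderHom, OrderHom.comp_coe, Function.comp_apply,
    coneCollapse_apply, σ_succ_apply, Fin.val_castSucc, Fin.val_succ]
  rw [Fin.le_def] at hij
  grind

variable (A : SimplicialObject (ModuleCat.{u} K))

/-- The décalage of a simplicial module. -/
def dec : SimplicialObject (ModuleCat.{u} K) := cone.op ⋙ A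

/-- The elements of the décalage with vanishing cone point. -/
def pathSubmodule : SimplicialSubmodule (dec A) where
  carrier n := LinearMap.ker (A.map (coneVertex n.unop).op).hom
  map_mem {m n} f x hx := by
    change (A.map (cone.map f.unop).op ≫ A.map (coneVertex n.unop).op).hom x = 0
    rw [← A.map_comp, ← op_comp, coneVertex_map]
    exact hx

/-- The path object: it is contractible and maps onto the part of `A` which vanishes in `H₀`. -/
def path : SimplicialObject (ModuleCat.{u} K) := (pathSubmodule A).toSimplicial

/-- The underlying element of an element of the path object. -/
def pathVal {n : ℕ} (x : path A _⦋n⦌) : A _⦋n + 1⦌ := Subtype.val x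

lemma path_δ_apply {n : ℕ} (i : Fin (n + 2)) (x : path A _⦋n + 1⦌) :
    pathVal A (((path A).δ i).hom x) = (A.map (SimplexCategory.δ i.succ).op).hom (pathVal A x) :=
  congrArg (fun g : ⦋n + 1⦌ ⟶ ⦋n + 2⦌ => (A.map g.op).hom (pathVal A x)) (cone_map_δ i)

lemma path_σ_apply {n : ℕ} (i : Fin (n + 1)) (x : path A _⦋n⦌) :
    pathVal A (((path A).σ i).hom x) = (A.map (SimplexCategory.σ i.succ).op).hom (pathVal A x) :=
  congrArg (fun g : ⦋n + 2⦌ ⟶ ⦋n + 1⦌ => (A.map g.op).hom (pathVal A x)) (cone_map_σ i)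

lemma map_op_comp_apply {m n p : ℕ} (f : ⦋n⦌ ⟶ ⦋m⦌) (g : ⦋p⦌ ⟶ ⦋n⦌) (x : A _⦋m⦌) :
    (A.map g.op).hom ((A.map f.op).hom x) = (A.map (g ≫ f).op).hom x := by
  rw [op_comp, A.map_comp]
  rfl

lemma coneCollapse_mem_path {n : ℕ} (j : Fin (n + 1)) (x : A _⦋n + 1⦌)
    (hx : x ∈ (pathSubmodule A).carrier (op ⦋n⦌)) :
    (A.map (coneCollapse j).op).hom x ∈ (pathSubmodule A).carrier (op ⦋n + 1⦌) :=
  (map_op_comp_apply A (coneCollapse j) (SimplexCategory.const ⦋0⦌ ⦋n + 2⦌ 0) x).trans hx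

/-- The operators of the contraction of the path object. -/
def pathContraction {n : ℕ} (j : Fin (n + 1)) : path A _⦋n⦌ ⟶ path A _⦋n + 1⦌ :=
  ModuleCat.ofHom ((A.map (coneCollapse j).op).hom.restrict (coneCollapse_mem_path A j))

lemma pathContraction_apply {n : ℕ} (j : Fin (n + 1)) (x : path A _⦋n⦌) :
    pathVal A ((pathContraction A j).hom x) = (A.map (coneCollapse j).op).hom (pathVal A x) := rfl

lemma pathContraction_comp_δ_apply {n : ℕ} (j : Fin (n + 1)) (i : Fin (n + 2)) (x : path A _⦋n⦌) :
    pathVal A ((pathContraction A j ≫ (path A).δ i).hom x) =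
      (A.map (SimplexCategory.δ i.succ ≫ coneCollapse j).op).hom (pathVal A x) := by
  rw [← map_op_comp_apply]
  exact path_δ_apply A i ((pathContraction A j).hom x)

lemma δ_comp_pathContraction_apply {n : ℕ} (j : Fin (n + 1)) (i : Fin (n + 2))
    (x : path A _⦋n + 1⦌) :
    pathVal A (((path A).δ i ≫ pathContraction A j).hom x) =
      (A.map (coneCollapse j ≫ SimplexCategory.δ i.succ).op).hom (pathVal A x) := by
  rw [← map_op_comp_apply, ← path_δ_apply]
  exact pathContraction_apply A j (((path A).δ i).hom x)

lemma pathContraction_comp_σ_apply {n : ℕ} (j : Fin (n + 1)) (i : Fin (n + 2)) (x : path A _⦋n⦌) :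
    pathVal A ((pathContraction A j ≫ (path A).σ i).hom x) =
      (A.map (SimplexCategory.σ i.succ ≫ coneCollapse j).op).hom (pathVal A x) := by
  rw [← map_op_comp_apply]
  exact path_σ_apply A i ((pathContraction A j).hom x)

lemma σ_comp_pathContraction_apply {n : ℕ} (j : Fin (n + 2)) (i : Fin (n + 1))
    (x : path A _⦋n⦌) :
    pathVal A (((path A).σ i ≫ pathContraction A j).hom x) =
      (A.map (coneCollapse j ≫ SimplexCategory.σ i.succ).op).hom (pathVal A x) := by
  rw [← map_op_comp_apply, ← path_σ_apply]
  exact pathContraction_apply A j (((path A).σ i).hom x)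

lemma path_hom_ext {X : ModuleCat.{u} K} {n : ℕ} {f g : X ⟶ path A _⦋n⦌}
    (h : ∀ x, pathVal A (f.hom x) = pathVal A (g.hom x)) : f = g := by
  ext x
  exact Subtype.ext (h x)

/-- The contraction of the path object. -/
def pathHomotopy : SimplicialObject.Homotopy (0 : path A ⟶ path A) (𝟙 (path A)) where
  h := pathContraction A
  h_zero_comp_δ_zero n := by
    refine path_hom_ext A fun x => ?_
    rw [pathContraction_comp_δ_apply, cone_δ_zero_collapse, op_id, A.map_id]
    rfl
  h_last_comp_δ_last n := by
    refine path_hom_ext A fun x => ?_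
    rw [pathContraction_comp_δ_apply, cone_δ_last_collapse, ← map_op_comp_apply]
    -- The last face factors through the restriction to the cone point, which is zero on the path
    -- object.
    exact (congrArg (A.map (SimplexCategory.const _ ⦋0⦌ 0).op).hom (Subtype.property x)).trans (map_zero _)
  h_succ_comp_δ_castSucc_of_lt i j hij := by
    refine path_hom_ext A fun x => ?_
    rw [pathContraction_comp_δ_apply, δ_comp_pathContraction_apply,
      cone_δ_castSucc_collapse_succ i j hij]
  h_succ_comp_δ_castSucc_succ j := by
    refine path_hom_ext A fun x => ?_
    rw [pathContraction_comp_δ_apply, pathContraction_comp_δ_apply, cone_δ_collapse_succ]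
  h_castSucc_comp_δ_succ_of_lt i j hij := by
    refine path_hom_ext A fun x => ?_
    rw [pathContraction_comp_δ_apply, δ_comp_pathContraction_apply,
      cone_δ_succ_collapse_castSucc i j hij]
  h_comp_σ_castSucc_of_le i j hij := by
    refine path_hom_ext A fun x => ?_
    rw [pathContraction_comp_σ_apply, σ_comp_pathContraction_apply,
      cone_σ_castSucc_collapse i j hij]
  h_comp_σ_succ_of_lt i j hij := by
    refine path_hom_ext A fun x => ?_
    rw [pathContraction_comp_σ_apply, σ_comp_pathContraction_apply,
      cone_σ_succ_collapse i j hij]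

end SimplicialModule
end

/-! ### The Künneth formula by dimension shifting -/

noncomputable section

open CategoryTheory Simplicial Opposite AlgebraicTopology TensorProduct

namespace SimplicialModule

variable {K : Type} [Field K]

/-- The `n`-th homology of a simplicial module, as a functor. -/
def homologyFunctor (K : Type) [Field K] (n : ℕ) :
    SimplicialObject (ModuleCat.{u} K) ⥤ ModuleCat.{u} K :=
  alternatingFaceMapComplex (ModuleCat.{u} K) ⋙ HomologicalComplex.homologyFunctor _ _ n

instance (n : ℕ) : (homologyFunctor.{u} K n).Additive := by
  unfold homologyFunctor
  infer_instance

/-- The dimension of the `n`-th homology of a simplicial module. -/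
def homologyRank (A : SimplicialObject (ModuleCat.{u} K)) (n : ℕ) : Cardinal.{u} :=
  Module.rank K ((homologyFunctor K n).obj A)

lemma rank_eq_of_iso {V W : ModuleCat.{u} K} (e : V ≅ W) : Module.rank K V = Module.rank K W :=
  e.toLinearEquiv.rank_eq

lemma homologyRank_eq_of_iso {A B : SimplicialObject (ModuleCat.{u} K)} (e : A ≅ B) (n : ℕ) :
    homologyRank A n = homologyRank B n :=
  rank_eq_of_iso ((homologyFunctor K n).mapIso e)

/-- The levelwise kernel of a map of simplicial modules. -/
def kerSubmodule {A B : SimplicialObject (ModuleCat.{u} K)} (f : A ⟶ B) :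
    SimplicialSubmodule A where
  carrier n := LinearMap.ker (f.app n).hom
  map_mem {m n} g x hx := by
    have h := LinearMap.congr_fun (congrArg ModuleCat.Hom.hom (f.naturality g)) x
    refine LinearMap.mem_ker.2 (h.trans ?_)
    have hx' : (f.app m).hom x = 0 := hx
    exact (congrArg (B.map g).hom hx').trans (map_zero _)

/-- The short complex of simplicial modules given by a map and its kernel. -/
def kerShortComplex {A B : SimplicialObject (ModuleCat.{u} K)} (f : A ⟶ B) :
    ShortComplex (SimplicialObject (ModuleCat.{u} K)) where
  f := (kerSubmodule f).ι
  g := f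
  zero := by
    ext n x
    exact x.2

/-- Tensoring with `B` preserves the short exactness of the kernel sequence of a levelwise
surjective map. -/
lemma kerShortComplex_tensor_shortExact {A A' : SimplicialObject (ModuleCat.{u} K)} (f : A ⟶ A')
    (hf : ∀ k : ℕ, Function.Surjective (f.app (op ⦋k⦌)).hom)
    (B : SimplicialObject (ModuleCat.{u} K)) :
    ((kerShortComplex f).map
      (tensorFunctor B ⋙ alternatingFaceMapComplex (ModuleCat.{u} K))).ShortExact := by
  apply HomologicalComplex.shortExact_of_degreewise_shortExact
  intro k
  apply ModuleCat.shortComplex_shortExact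
  · exact rTensor_exact (B.obj (op ⦋k⦌))
      (f := (LinearMap.ker (f.app (op ⦋k⦌)).hom).subtype) (g := (f.app (op ⦋k⦌)).hom)
      (LinearMap.exact_subtype_ker_map _) (hf k)
  · exact Module.Flat.rTensor_preserves_injective_linearMap _ (Submodule.injective_subtype _)
  · exact LinearMap.rTensor_surjective (B.obj (op ⦋k⦌)) (hf k)

/-- Tensoring with `V`, as a functor. -/
def tensorLeftFunctor (V : ModuleCat.{u} K) : ModuleCat.{u} K ⥤ ModuleCat.{u} K where
  obj W := ModuleCat.of K (V ⊗[K] W)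
  map f := ModuleCat.ofHom (f.hom.lTensor V)
  map_id W := by
    ext : 1
    exact LinearMap.lTensor_id _ _
  map_comp f g := by
    ext : 1
    exact LinearMap.lTensor_comp _ _ _

instance (V : ModuleCat.{u} K) : (tensorLeftFunctor V).Additive where
  map_add {_ _ f g} := by
    ext : 1
    exact LinearMap.lTensor_add V f.hom g.hom

instance (V : ModuleCat.{u} K) : (tensorLeftFunctor V).PreservesHomology := by
  apply Functor.preservesHomology_of_map_exact
  intro S hS
  apply ModuleCat.shortComplex_exact
  exact Module.Flat.lTensor_exact V
    ((ShortComplex.ShortExact.moduleCat_exact_iff_function_exact _).1 hS)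

/-- The constant simplicial module. -/
abbrev const (V : ModuleCat.{u} K) : SimplicialObject (ModuleCat.{u} K) :=
  (Functor.const SimplexCategoryᵒᵖ).obj V

/-- Tensoring with $V$ over a field is exact, hence commutes with homology. -/
lemma homologyRank_tensor_const (V : ModuleCat.{u} K) (B : SimplicialObject (ModuleCat.{u} K))
    (n : ℕ) :
    homologyRank (tensor (const V) B) n = Module.rank K V * homologyRank B n := by
  let e : tensor (const V) B ≅
      ((SimplicialObject.whiskering _ _).obj (tensorLeftFunctor V)).obj B :=
    NatIso.ofComponents (fun _ => Iso.refl _)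
  let e' : (alternatingFaceMapComplex (ModuleCat.{u} K)).obj (tensor (const V) B) ≅
      ((tensorLeftFunctor V).mapHomologicalComplex _).obj
        ((alternatingFaceMapComplex (ModuleCat.{u} K)).obj B) :=
    (alternatingFaceMapComplex (ModuleCat.{u} K)).mapIso e ≪≫
      eqToIso (congrArg (fun F => F.obj B)
        (map_alternatingFaceMapComplex (tensorLeftFunctor V)).symm)
  have e'' := (HomologicalComplex.homologyFunctor _ _ n).mapIso e' ≪≫
    ShortComplex.mapHomologyIso
      (((alternatingFaceMapComplex (ModuleCat.{u} K)).obj B).sc n) (tensorLeftFunctor V)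
  exact (rank_eq_of_iso e'').trans (rank_tensorProduct' ..)

variable (A : SimplicialObject (ModuleCat.{u} K))

/-- The difference of the end points of an edge. -/
def edgeBoundary : A _⦋1⦌ →ₗ[K] A _⦋0⦌ := (A.δ 0).hom - (A.δ 1).hom

/-- The quotient of the vertices by the differences of the end points of the edges. -/
def pi₀ : ModuleCat.{u} K := ModuleCat.of K (A _⦋0⦌ ⧸ LinearMap.range (edgeBoundary A))

/-- The edge of $x$ from vertex $i$ to vertex $j$ has this difference as boundary. -/
lemma vertex_sub_vertex_mem {n : ℕ} (i j : Fin (n + 1)) (h : i ≤ j) (x : A _⦋n⦌) :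
    (A.map (SimplexCategory.const ⦋0⦌ ⦋n⦌ j).op).hom x -
      (A.map (SimplexCategory.const ⦋0⦌ ⦋n⦌ i).op).hom x ∈ LinearMap.range (edgeBoundary A) := by
  refine ⟨(A.map (SimplexCategory.mkOfLe i j h).op).hom x, ?_⟩
  have h₀ : SimplexCategory.δ (0 : Fin 2) ≫ SimplexCategory.mkOfLe i j h =
      SimplexCategory.const ⦋0⦌ ⦋n⦌ j := by
    ext t
    fin_cases t
    rfl
  have h₁ : SimplexCategory.δ (1 : Fin 2) ≫ SimplexCategory.mkOfLe i j h =
      SimplexCategory.const ⦋0⦌ ⦋n⦌ i := by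
    ext t
    fin_cases t
    rfl
  rw [← h₀, ← h₁, ← map_op_comp_apply, ← map_op_comp_apply]
  rfl

/-- The class of the initial vertex. -/
def toPi₀ : A ⟶ const (pi₀ A) where
  app n := ModuleCat.ofHom ((LinearMap.range (edgeBoundary A)).mkQ ∘ₗ
    (A.map (SimplexCategory.const ⦋0⦌ n.unop 0).op).hom)
  naturality m n f := by
    ext x
    -- The initial vertex of $f^*x$ is the vertex $f(0)$ of $x$, which has the same class as the
    -- vertex $0$.
    refine (Submodule.Quotient.eq _).2 ?_
    have h := vertex_sub_vertex_mem A (n := m.unop.len) 0 (f.unop.toOrderHom 0) (Fin.zero_le _) x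
    have h' : (A.map (SimplexCategory.const ⦋0⦌ n.unop 0).op).hom ((A.map f).hom x) =
        (A.map (SimplexCategory.const ⦋0⦌ m.unop (f.unop.toOrderHom 0)).op).hom x := by
      change (A.map f ≫ A.map (SimplexCategory.const ⦋0⦌ n.unop 0).op).hom x = _
      rw [← A.map_comp]
      rfl
    exact (congrArg (· - _ ∈ _) h').mpr h

/-- A linear section of the quotient map onto `π₀`. -/
def pi₀Section : pi₀ A →ₗ[K] A _⦋0⦌ :=
  ((LinearMap.range (edgeBoundary A)).mkQ.exists_rightInverse_of_surjective
    (Submodule.range_mkQ _)).choose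

lemma mkQ_pi₀Section (v : pi₀ A) :
    (LinearMap.range (edgeBoundary A)).mkQ (pi₀Section A v) = v :=
  LinearMap.congr_fun ((LinearMap.range (edgeBoundary A)).mkQ.exists_rightInverse_of_surjective
    (Submodule.range_mkQ _)).choose_spec v

/-- A section of `toPi₀`. -/
def ofPi₀ : const (pi₀ A) ⟶ A where
  app n := ModuleCat.ofHom ((A.map (SimplexCategory.const n.unop ⦋0⦌ 0).op).hom ∘ₗ pi₀Section A)
  naturality m n f := by
    ext x
    have h : A.map (SimplexCategory.const m.unop ⦋0⦌ 0).op ≫ A.map f =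
        A.map (SimplexCategory.const n.unop ⦋0⦌ 0).op := by
      rw [← A.map_comp]
      rfl
    exact (LinearMap.congr_fun (congrArg ModuleCat.Hom.hom h) (pi₀Section A x)).symm

lemma ofPi₀_toPi₀ : ofPi₀ A ≫ toPi₀ A = 𝟙 _ := by
  ext n x
  have h : A.map (SimplexCategory.const n.unop ⦋0⦌ 0).op ≫
      A.map (SimplexCategory.const ⦋0⦌ n.unop 0).op = 𝟙 _ := by
    rw [← A.map_comp, ← op_comp,
      show SimplexCategory.const ⦋0⦌ n.unop 0 ≫ SimplexCategory.const n.unop ⦋0⦌ 0 = 𝟙 _ from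
        SimplexCategory.Hom.ext_zero_left _ _, op_id, A.map_id]
  exact (congrArg (LinearMap.range (edgeBoundary A)).mkQ
    (LinearMap.congr_fun (congrArg ModuleCat.Hom.hom h) (pi₀Section A x))).trans
      (mkQ_pi₀Section A x)

/-- The part of `A` which vanishes in `π₀`. -/
def base : SimplicialObject (ModuleCat.{u} K) := (kerSubmodule (toPi₀ A)).toSimplicial

/-- The splitting of `A` as the sum of `base A` and a constant simplicial module. -/
def baseSplitting : (kerShortComplex (toPi₀ A)).Splitting where
  r := (kerSubmodule (toPi₀ A)).lift (𝟙 A - toPi₀ A ≫ ofPi₀ A) (fun n x => by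
    have h : (𝟙 A - toPi₀ A ≫ ofPi₀ A) ≫ toPi₀ A = 0 := by
      rw [Preadditive.sub_comp, Category.assoc, ofPi₀_toPi₀, Category.id_comp, Category.comp_id,
        sub_self]
    exact LinearMap.congr_fun (congrArg (fun g => ModuleCat.Hom.hom (NatTrans.app g n)) h) x)
  s := ofPi₀ A
  f_r := by
    ext n x
    apply Subtype.ext
    have hx : ((toPi₀ A).app n).hom (Subtype.val x) = 0 := x.2
    have : ((ofPi₀ A).app n).hom (((toPi₀ A).app n).hom (Subtype.val x)) = 0 :=
      (congrArg ((ofPi₀ A).app n).hom hx).trans (map_zero _)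
    exact (congrArg (Subtype.val x - ·) this).trans (sub_zero _)
  s_g := ofPi₀_toPi₀ A
  id := by
    change (𝟙 A - toPi₀ A ≫ ofPi₀ A) + _ = 𝟙 A
    exact sub_add_cancel _ _

/-- An additive functor preserves the splitting of $A$, so ranks add without a long exact sequence.
-/
lemma homologyRank_tensor_eq_base_add (B : SimplicialObject (ModuleCat.{u} K)) (n : ℕ) :
    homologyRank (tensor A B) n =
      homologyRank (tensor (base A) B) n + Module.rank K (pi₀ A) * homologyRank B n := by
  rw [← homologyRank_tensor_const]
  exact ModuleCat.free_shortExact_rank_add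
    ((baseSplitting A).map (tensorFunctor B ⋙ homologyFunctor K n)).shortExact

/-- The projection of the path object to `A`. -/
def pathProj : path A ⟶ A :=
  (pathSubmodule A).ι ≫
    { app := fun n => A.map (coneIncl.app n.unop).op
      naturality := fun m n f => by
        change A.map _ ≫ A.map _ = A.map _ ≫ A.map _
        rw [← A.map_comp, ← A.map_comp]
        rfl }

/-- The initial vertex of the projection of $x$ is the vertex $1$ of $x$, joined by an edge to the
cone point, where $x$ vanishes. -/
lemma pathProj_mem (n : SimplexCategoryᵒᵖ) (x : (path A).obj n) :
    ((pathProj A).app n).hom x ∈ (kerSubmodule (toPi₀ A)).carrier n := by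
  refine (Submodule.Quotient.mk_eq_zero _).2 ?_
  have h := vertex_sub_vertex_mem A (n := n.unop.len + 1) 0 1 (Fin.zero_le _) x.1
  have hx : (A.map (SimplexCategory.const ⦋0⦌ ⦋n.unop.len + 1⦌ 0).op).hom x.1 = 0 := x.2
  rw [hx, sub_zero] at h
  exact (congrArg (· ∈ _) (map_op_comp_apply A (SimplexCategory.δ (0 : Fin (n.unop.len + 2)))
    (SimplexCategory.const ⦋0⦌ ⦋n.unop.len⦌ 0) x.1)).mpr h

/-- The projection of the path object to the part of `A` which vanishes in `π₀`. -/
def pathToBase : path A ⟶ base A := (kerSubmodule (toPi₀ A)).lift (pathProj A) (pathProj_mem A)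

/-- The degenerate simplex $s_0x$ lifts $x$, but its cone point is the initial vertex of $x$ instead
of $0$. That vertex bounds an edge, and the lift is corrected by a degenerate simplex built from
this edge. -/
lemma pathToBase_surjective (k : ℕ) :
    Function.Surjective ((pathToBase A).app (op ⦋k⦌)).hom := by
  rintro ⟨x, hx⟩
  obtain ⟨z, hz⟩ := (Submodule.Quotient.mk_eq_zero _).1 hx
  let p : ⦋k + 1⦌ ⟶ ⦋1⦌ := SimplexCategory.mkHom ⟨Fin.cases 0 fun _ => 1, by
    intro a b hab
    induction a using Fin.cases with
    | zero => simp
    | succ a =>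
      induction b using Fin.cases with
      | zero => simp at hab
      | succ b => simp⟩
  -- The edge is normalized so that $d_0z'=0$ while $d_1z'=d_0z-d_1z$ is the initial vertex of $x$.
  -- Pulled back along `p`, it corrects the cone point without changing the opposite face.
  let z' : A _⦋1⦌ := (A.map (SimplexCategory.σ (0 : Fin 1)).op).hom
    ((A.map (SimplexCategory.δ (0 : Fin 2)).op).hom z) - z
  have hs₀ (m : ℕ) : SimplexCategory.δ (0 : Fin (m + 2)) ≫
      SimplexCategory.σ (0 : Fin (m + 1)) = 𝟙 _ := SimplexCategory.δ_comp_σ_self (i := 0)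
  have hs₁ : SimplexCategory.δ (1 : Fin 2) ≫ SimplexCategory.σ (0 : Fin 1) = 𝟙 _ :=
    SimplexCategory.δ_comp_σ_succ (i := 0)
  have hz₀ : (A.map (SimplexCategory.δ (0 : Fin 2)).op).hom z' = 0 := by
    rw [map_sub, map_op_comp_apply, hs₀, op_id, A.map_id]
    exact sub_self _
  have hz₁ : (A.map (SimplexCategory.δ (1 : Fin 2)).op).hom z' =
      (A.map (SimplexCategory.const ⦋0⦌ ⦋k⦌ 0).op).hom x := by
    rw [map_sub, map_op_comp_apply, hs₁, op_id, A.map_id]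
    exact hz
  let y : A _⦋k + 1⦌ := (A.map (SimplexCategory.σ (0 : Fin (k + 1))).op).hom x -
    (A.map p.op).hom z'
  have hy₀ : (A.map (SimplexCategory.δ (0 : Fin (k + 2))).op).hom y = x := by
    have hp : SimplexCategory.δ (0 : Fin (k + 2)) ≫ p =
        SimplexCategory.const ⦋k⦌ ⦋0⦌ 0 ≫ SimplexCategory.δ (0 : Fin 2) := by
      ext t
      rfl
    rw [map_sub, map_op_comp_apply, hs₀, op_id, A.map_id,
      map_op_comp_apply, hp, ← map_op_comp_apply, hz₀, map_zero, sub_zero]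
    rfl
  have hy₁ : (A.map (SimplexCategory.const ⦋0⦌ ⦋k + 1⦌ 0).op).hom y = 0 := by
    have hp : SimplexCategory.const ⦋0⦌ ⦋k + 1⦌ 0 ≫ p = SimplexCategory.δ (1 : Fin 2) := by
      ext t
      fin_cases t
      rfl
    have hσ : SimplexCategory.const ⦋0⦌ ⦋k + 1⦌ 0 ≫ SimplexCategory.σ (0 : Fin (k + 1)) =
        SimplexCategory.const ⦋0⦌ ⦋k⦌ 0 := by
      ext t
      rfl
    rw [map_sub, map_op_comp_apply, map_op_comp_apply, hp, hσ, hz₁, sub_self]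
  exact ⟨⟨y, hy₁⟩, Subtype.ext hy₀⟩

/-- The loop object. -/
def loop : SimplicialObject (ModuleCat.{u} K) := (kerSubmodule (pathToBase A)).toSimplicial

/-- The contraction survives tensoring with $B$, so identity and zero agree on homology. -/
lemma path_tensor_homology_isZero (B : SimplicialObject (ModuleCat.{u} K)) (n : ℕ) :
    Limits.IsZero ((homologyFunctor K n).obj (tensor (path A) B)) := by
  rw [Limits.IsZero.iff_id_eq_zero]
  have h := (homotopyTensor (pathHomotopy A) B).map_homology_eq n
  have h₀ : (tensorFunctor B ⋙ homologyFunctor K n).map (0 : path A ⟶ path A) = 0 :=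
    Functor.map_zero _ _ _
  have h₁ := (tensorFunctor B ⋙ homologyFunctor K n).map_id (path A)
  exact h₁.symm.trans (h.symm.trans h₀)

/-- The connecting map for `loop`, `path` and `base` is an isomorphism because the middle term is
acyclic. -/
lemma homologyRank_tensor_base_succ (B : SimplicialObject (ModuleCat.{u} K)) (n : ℕ) :
    homologyRank (tensor (base A) B) (n + 1) = homologyRank (tensor (loop A) B) n :=
  rank_eq_of_iso ((kerShortComplex_tensor_shortExact (pathToBase A)
    (pathToBase_surjective A) B).δIso (n + 1) n (by simp)
      (path_tensor_homology_isZero A B _) (path_tensor_homology_isZero A B _))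

/-- In degree $0$ homology preserves epimorphisms, and the source has none. -/
lemma homologyRank_tensor_base_zero (B : SimplicialObject (ModuleCat.{u} K)) :
    homologyRank (tensor (base A) B) 0 = 0 := by
  have hS := kerShortComplex_tensor_shortExact (pathToBase A) (pathToBase_surjective A) B
  have := hS.epi_g
  have hepi := HomologicalComplex.epi_homologyMap_of_epi_of_not_rel
    ((kerShortComplex (pathToBase A)).map
      (tensorFunctor B ⋙ alternatingFaceMapComplex (ModuleCat.{u} K))).g 0 (by simp)
  have : Subsingleton ((homologyFunctor K 0).obj (tensor (base A) B)) :=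
    ModuleCat.subsingleton_of_isZero
    (@Limits.IsZero.of_epi _ _ _ _ _ _ hepi (path_tensor_homology_isZero A B 0))
  exact rank_subsingleton' _ _

lemma homologyRank_const (V : ModuleCat.{u} K) (n : ℕ) :
    homologyRank (const V) n = if n = 0 then Module.rank K V else 0 := by
  have e := (HomologicalComplex.homologyFunctor _ _ n).mapIso (alternatingFaceMapComplexConst.app V)
  refine (rank_eq_of_iso e).trans ?_
  split_ifs with h
  · subst h
    exact rank_eq_of_iso (ChainComplex.alternatingConstHomologyZero V)
  · have : Subsingleton ((HomologicalComplex.homologyFunctor (ModuleCat.{u} K) _ n).obj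
        (ChainComplex.alternatingConst.obj V)) := ModuleCat.subsingleton_of_isZero
      (ChainComplex.alternatingConst_exactAt V n h).isZero_homology
    exact rank_subsingleton' _ _

/-- The one-dimensional vector space. -/
abbrev unitModule (K : Type) [Field K] : ModuleCat.{u} K := ModuleCat.of K (ULift.{u} K)

lemma rank_unitModule : Module.rank K (unitModule.{u} K) = 1 := by
  have h := (ULift.moduleEquiv.{0, 0, u} : ULift.{u} K ≃ₗ[K] K).lift_rank_eq
  rw [Module.rank_self, Cardinal.lift_one, Cardinal.lift_eq_one] at h
  exact h

lemma homologyRank_tensor_unit (n : ℕ) :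
    homologyRank (tensor A (const (unitModule.{u} K))) n = homologyRank A n := by
  refine homologyRank_eq_of_iso (NatIso.ofComponents (fun m => LinearEquiv.toModuleIso
    ((TensorProduct.congr (LinearEquiv.refl K _) ULift.moduleEquiv).trans
      (TensorProduct.rid K (A.obj m)))) ?_) n
  intro m m' f
  ext : 1
  apply TensorProduct.ext'
  intro x y
  exact (map_smul (A.map f).hom _ _).symm

lemma homologyRank_zero : homologyRank A 0 = Module.rank K (pi₀ A) := by
  rw [← homologyRank_tensor_unit, homologyRank_tensor_eq_base_add, homologyRank_tensor_base_zero,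
    homologyRank_const, if_pos rfl, rank_unitModule, zero_add, mul_one]

/-- The dimension shift for $B$ the constant one-dimensional object; the `pi₀` summand contributes
only in degree $0$. -/
lemma homologyRank_succ (n : ℕ) : homologyRank A (n + 1) = homologyRank (loop A) n := by
  rw [← homologyRank_tensor_unit, homologyRank_tensor_eq_base_add, homologyRank_tensor_base_succ,
    homologyRank_const, if_neg n.succ_ne_zero, mul_zero, add_zero, homologyRank_tensor_unit]

/-- The Künneth formula for the dimensions of the homology. -/
theorem homologyRank_tensor (B : SimplicialObject (ModuleCat.{u} K)) (n : ℕ) :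
    homologyRank (tensor A B) n =
      ∑ p ∈ Finset.HasAntidiagonal.antidiagonal n, homologyRank A p.1 * homologyRank B p.2 := by
  induction n generalizing A with
  | zero =>
    rw [homologyRank_tensor_eq_base_add, homologyRank_tensor_base_zero, zero_add,
      ← homologyRank_zero]
    simp
  | succ n ih =>
    -- The `pi₀` summand is the term with first degree $0$; the induction hypothesis for `loop A`
    -- gives the others, shifted by one.
    rw [homologyRank_tensor_eq_base_add, homologyRank_tensor_base_succ, ih,
      Finset.Nat.antidiagonal_succ, Finset.sum_cons, Finset.sum_map, ← homologyRank_zero, add_comm]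
    simp [homologyRank_succ]

end SimplicialModule
end

/-! ### Singular chains as free simplicial modules, and Betti numbers -/

noncomputable section

open CategoryTheory Simplicial Opposite AlgebraicTopology TensorProduct

namespace SimplicialModule

variable (K : Type) [Field K]

/-- The free module functor. -/
def freeFunctor : Type u ⥤ ModuleCat.{u} K where
  obj X := ModuleCat.of K (X →₀ K)
  map f := ModuleCat.ofHom (Finsupp.lmapDomain K K f)
  map_id X := by
    ext : 1
    exact Finsupp.lmapDomain_id K K
  map_comp f g := by
    ext : 1
    exact Finsupp.lmapDomain_comp K K f g

/-- The inclusion of a summand of a free module. -/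
def freeIncl {X : Type u} (x : X) : unitModule.{u} K ⟶ ModuleCat.of K (X →₀ K) :=
  ModuleCat.ofHom (Finsupp.lsingle (M := K) (R := K) x ∘ₗ
    (ULift.moduleEquiv : ULift.{u} K ≃ₗ[K] K).toLinearMap)

/-- The map out of a free module given by a family of maps. -/
def freeDesc {X : Type u} {V : ModuleCat.{u} K} (f : X → (unitModule.{u} K ⟶ V)) :
    ModuleCat.of K (X →₀ K) ⟶ V :=
  ModuleCat.ofHom (Finsupp.lsum K fun x =>
    (f x).hom ∘ₗ (ULift.moduleEquiv : ULift.{u} K ≃ₗ[K] K).symm.toLinearMap)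

lemma freeIncl_freeDesc {X : Type u} {V : ModuleCat.{u} K} (f : X → (unitModule.{u} K ⟶ V))
    (x : X) : freeIncl K x ≫ freeDesc K f = f x := by
  ext y
  change Finsupp.lsum K _ (Finsupp.single x y.down) = _
  rw [Finsupp.lsum_single]
  rfl

lemma free_hom_ext {X : Type u} {V : ModuleCat.{u} K} {f g : ModuleCat.of K (X →₀ K) ⟶ V}
    (h : ∀ x, freeIncl K x ≫ f = freeIncl K x ≫ g) : f = g := by
  ext : 1
  apply Finsupp.lhom_ext
  intro x c
  exact LinearMap.congr_fun (congrArg ModuleCat.Hom.hom (h x)) (ULift.up c)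

/-- A coproduct of copies of the one-dimensional space is a free module. -/
def sigmaIso (X : Type u) : (∐ fun _ : X => unitModule.{u} K) ≅ ModuleCat.of K (X →₀ K) where
  hom := Limits.Sigma.desc fun x => freeIncl K x
  inv := freeDesc K fun x => Limits.Sigma.ι (fun _ : X => unitModule.{u} K) x
  hom_inv_id := by
    apply Limits.Sigma.hom_ext
    intro x
    rw [Limits.Sigma.ι_desc_assoc, freeIncl_freeDesc, Category.comp_id]
  inv_hom_id := by
    apply free_hom_ext
    intro x
    rw [← Category.assoc, freeIncl_freeDesc, Limits.Sigma.ι_desc, Category.comp_id]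

/-- Coproducts of copies of the one-dimensional space are free modules. -/
def sigmaConstIso : Limits.sigmaConst.obj (unitModule.{u} K) ≅ freeFunctor.{u} K :=
  NatIso.ofComponents (sigmaIso K) (by
    intro X Y f
    apply Limits.Sigma.hom_ext
    intro x
    have h₁ : Limits.Sigma.ι (fun _ : X => unitModule.{u} K) x ≫
        (Limits.sigmaConst.obj (unitModule.{u} K)).map f ≫ (sigmaIso K Y).hom =
          freeIncl K (f x) := by
      simp [sigmaIso]
    have h₂ : freeIncl K x ≫ (freeFunctor K).map f = freeIncl K (f x) := by
      ext y
      exact Finsupp.mapDomain_single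
    have h₃ : Limits.Sigma.ι (fun _ : X => unitModule.{u} K) x ≫ (sigmaIso K X).hom =
        freeIncl K x := Limits.Sigma.ι_desc _ _
    exact h₁.trans (h₂.symm.trans (congrArg (· ≫ (freeFunctor K).map f) h₃.symm)))

/-- The simplicial module of singular chains. -/
def singular (X : Type u) [TopologicalSpace X] : SimplicialObject (ModuleCat.{u} K) :=
  ((SimplicialObject.whiskering _ _).obj (freeFunctor K)).obj (TopCat.toSSet.obj (TopCat.of X))

/-- The singular chain complex as the alternating face map complex of the free simplicial module. -/
def rationalSingularChainsIso (X : Type u) [TopologicalSpace X] :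
    rationalSingularChains X ≅ (alternatingFaceMapComplex (ModuleCat.{u} ℚ)).obj (singular ℚ X) :=
  (alternatingFaceMapComplex (ModuleCat.{u} ℚ)).mapIso
    (((SimplicialObject.whiskering _ _).mapIso (sigmaConstIso ℚ)).app
      (TopCat.toSSet.obj (TopCat.of X)))

/-- A singular simplex of a product is a pair of singular simplices. -/
def singularProdEquiv (X Y : Type u) [TopologicalSpace X] [TopologicalSpace Y]
    (n : SimplexCategoryᵒᵖ) :
    (TopCat.toSSet.obj (TopCat.of (X × Y))).obj n ≃
      (TopCat.toSSet.obj (TopCat.of X)).obj n × (TopCat.toSSet.obj (TopCat.of Y)).obj n where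
  toFun s := ((TopCat.toSSet.map (TopCat.ofHom ContinuousMap.fst)).app n s,
    (TopCat.toSSet.map (TopCat.ofHom ContinuousMap.snd)).app n s)
  invFun p := ULift.up (TopCat.ofHom (p.1.down.hom.prodMk p.2.down.hom))
  left_inv _ := rfl
  right_inv _ := rfl

/-- The singular chains on a product. -/
def singularProdIso (X Y : Type u) [TopologicalSpace X] [TopologicalSpace Y] :
    singular K (X × Y) ≅ tensor (singular K X) (singular K Y) :=
  NatIso.ofComponents (fun n => LinearEquiv.toModuleIso
    ((Finsupp.domLCongr (singularProdEquiv X Y n)).trans (finsuppTensorFinsupp' K _ _).symm)) (by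
      intro m n f
      apply free_hom_ext
      intro s
      ext c
      change (finsuppTensorFinsupp' K _ _).symm (Finsupp.domLCongr _ (Finsupp.mapDomain _
        (Finsupp.single s c.down))) = TensorProduct.map (Finsupp.lmapDomain K K _)
          (Finsupp.lmapDomain K K _) ((finsuppTensorFinsupp' K _ _).symm
            (Finsupp.domLCongr _ (Finsupp.single s c.down)))
      rw [Finsupp.mapDomain_single, Finsupp.domLCongr_single, Finsupp.domLCongr_single,
        finsuppTensorFinsupp'_symm_single_eq_single_one_tmul,
        finsuppTensorFinsupp'_symm_single_eq_single_one_tmul, TensorProduct.map_tmul,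
        Finsupp.lmapDomain_apply, Finsupp.lmapDomain_apply, Finsupp.mapDomain_single,
        Finsupp.mapDomain_single]
      rfl)

lemma rank_homology_rationalSingularChains (X : Type u) [TopologicalSpace X] (n : ℕ) :
    Module.rank ℚ ((rationalSingularChains X).homology n) = homologyRank (singular ℚ X) n :=
  rank_eq_of_iso ((HomologicalComplex.homologyFunctor _ _ n).mapIso (rationalSingularChainsIso X))

end SimplicialModule

/-- The `n`-th rational Betti number of a space, as a cardinal. -/
def bettiRank (X : Type u) [TopologicalSpace X] (n : ℕ) : Cardinal.{u} :=
  Module.rank ℚ ((rationalSingularChains X).homology n)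

/-- The Künneth formula for the Betti numbers. -/
lemma bettiRank_prod (X Y : Type u) [TopologicalSpace X] [TopologicalSpace Y] (n : ℕ) :
    bettiRank (X × Y) n =
      ∑ p ∈ Finset.HasAntidiagonal.antidiagonal n, bettiRank X p.1 * bettiRank Y p.2 := by
  simp only [bettiRank, SimplicialModule.rank_homology_rationalSingularChains]
  rw [SimplicialModule.homologyRank_eq_of_iso (SimplicialModule.singularProdIso ℚ X Y),
    SimplicialModule.homologyRank_tensor]

lemma bettiRank_congr {X Y : Type u} [TopologicalSpace X] [TopologicalSpace Y] (e : X ≃ₜ Y)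
    (n : ℕ) : bettiRank X n = bettiRank Y n :=
  SimplicialModule.rank_eq_of_iso ((HomologicalComplex.homologyFunctor _ _ n).mapIso
    (((AlgebraicTopology.singularChainComplexFunctor (ModuleCat.{u} ℚ)).obj
      (ModuleCat.of ℚ (ULift.{u} ℚ))).mapIso (TopCat.isoOfHomeo e)))

lemma bettiRank_of_unique (X : Type u) [TopologicalSpace X] [Unique X] (n : ℕ) :
    bettiRank X n = if n = 0 then 1 else 0 := by
  have e := singularChainComplexFunctorIsoOfTotallyDisconnectedSpace (ModuleCat.{u} ℚ)
    (SimplicialModule.unitModule.{u} ℚ) (TopCat.of X)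
  have e' := (HomologicalComplex.homologyFunctor _ _ n).mapIso e
  refine (SimplicialModule.rank_eq_of_iso e').trans ?_
  split_ifs with h
  · subst h
    refine (SimplicialModule.rank_eq_of_iso (ChainComplex.alternatingConstHomologyZero _)).trans ?_
    refine (SimplicialModule.rank_eq_of_iso (SimplicialModule.sigmaIso ℚ X)).trans ?_
    exact (rank_finsupp_self ℚ _).trans (by simp)
  · have : Subsingleton ((HomologicalComplex.homologyFunctor (ModuleCat.{u} ℚ) _ n).obj
        (ChainComplex.alternatingConst.obj (∐ fun _ : TopCat.of X =>
          SimplicialModule.unitModule.{u} ℚ))) := ModuleCat.subsingleton_of_isZero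
      (ChainComplex.alternatingConst_exactAt _ n h).isZero_homology
    exact rank_subsingleton' _ _

/-- The coefficients of `p` are the Betti numbers of `X`. -/
def IsPoincarePolynomial (X : Type u) [TopologicalSpace X] (p : Polynomial ℕ) : Prop :=
  ∀ k, bettiRank X k = (p.coeff k : Cardinal)

/-- Finiteness of each Betti number and their eventual vanishing are packed into one polynomial.
Products of spaces then become products of polynomials, and the Euler characteristic becomes the
value at $-1$. -/
lemma hasFiniteRationalHomology_iff (X : Type u) [TopologicalSpace X] :
    HasFiniteRationalHomology X ↔ ∃ p, IsPoincarePolynomial X p := by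
  simp only [HasFiniteRationalHomology, IsPoincarePolynomial, bettiRank,
    ← Module.rank_lt_aleph0_iff, ← rank_zero_iff (R := ℚ)]
  constructor
  · rintro ⟨h, N, hN⟩
    refine ⟨∑ k ∈ Finset.range N, Polynomial.monomial k
      (Cardinal.toNat (Module.rank ℚ ((rationalSingularChains X).homology k))), fun k => ?_⟩
    rw [Polynomial.finsetSum_coeff]
    simp only [Polynomial.coeff_monomial, Finset.sum_ite_eq', Finset.mem_range]
    split_ifs with hk
    · exact (Cardinal.cast_toNat_of_lt_aleph0 (h k)).symm
    · simpa using hN k (not_lt.1 hk)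
  · rintro ⟨p, hp⟩
    refine ⟨fun k => hp k ▸ Cardinal.natCast_lt_aleph0, p.natDegree + 1, fun k hk => ?_⟩
    rw [hp, Polynomial.coeff_eq_zero_of_natDegree_lt (by omega), Nat.cast_zero]

namespace IsPoincarePolynomial

variable {X Y : Type u} [TopologicalSpace X] [TopologicalSpace Y] {p q : Polynomial ℕ}

lemma eulerCharacteristic_eq (hp : IsPoincarePolynomial X p) :
    eulerCharacteristic X = p.eval₂ (Nat.castRingHom ℤ) (-1) := by
  have hr : ∀ k, Module.finrank ℚ ((rationalSingularChains X).homology k) = p.coeff k := by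
    intro k
    rw [Module.finrank, show Module.rank ℚ _ = _ from hp k, Cardinal.toNat_natCast]
  rw [eulerCharacteristic,
    HomologicalComplex.homologyEulerChar_eq_sum_finSet_of_finrankSupport_subset _
      (Finset.range (p.natDegree + 1)), Polynomial.eval₂_eq_sum_range]
  · refine Finset.sum_congr rfl fun k _ => ?_
    rw [hr, mul_comm]
    simp
  · rw [GradedObject.finrankSupport_subset_iff]
    intro k hk
    rw [hr, Polynomial.coeff_eq_zero_of_natDegree_lt (by simpa using hk)]

lemma prod (hp : IsPoincarePolynomial X p) (hq : IsPoincarePolynomial Y q) :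
    IsPoincarePolynomial (X × Y) (p * q) := by
  intro k
  rw [bettiRank_prod, Polynomial.coeff_mul]
  push_cast
  exact Finset.sum_congr rfl fun i _ => by rw [hp, hq]

lemma congr (hp : IsPoincarePolynomial X p) (e : X ≃ₜ Y) : IsPoincarePolynomial Y p :=
  fun k => (bettiRank_congr e k).symm.trans (hp k)

lemma of_unique [Unique X] : IsPoincarePolynomial X 1 := by
  intro k
  rw [bettiRank_of_unique, Polynomial.coeff_one]
  split_ifs <;> simp

lemma fin_pow (hp : IsPoincarePolynomial X p) (n : ℕ) :
    IsPoincarePolynomial (Fin n → X) (p ^ n) := by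
  induction n with
  | zero => exact (pow_zero p) ▸ of_unique
  | succ n ih =>
    rw [pow_succ']
    exact (hp.prod ih).congr
      { toEquiv := Fin.consEquiv fun _ : Fin (n + 1) => X
        continuous_toFun := by
          refine continuous_pi fun i => ?_
          induction i using Fin.cases with
          | zero => exact continuous_fst
          | succ i => exact (continuous_apply i).comp continuous_snd
        continuous_invFun :=
          (continuous_apply 0).prodMk (continuous_pi fun i => continuous_apply i.succ) }

lemma pi {ι : Type} [Fintype ι] (hp : IsPoincarePolynomial X p) :
    IsPoincarePolynomial (ι → X) (p ^ Fintype.card ι) :=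
  (hp.fin_pow _).congr (Homeomorph.piCongrLeft (Y := fun _ => X) (Fintype.equivFin ι).symm)

end IsPoincarePolynomial

end

noncomputable section

/-! ### Fixed points of tuples of permutations -/

lemma tupleGraph_adj {n m : ℕ} (π : Fin m → Equiv.Perm (Fin n)) (a b : Fin n) :
    (tupleGraph π).Adj a b ↔ a ≠ b ∧ ((∃ j, π j a = b) ∨ ∃ j, π j b = a) :=
  SimpleGraph.fromRel_adj _ _ _

lemma mem_simultaneousFixedPoints_iff {M : Type u} {n m : ℕ} (π : Fin m → Equiv.Perm (Fin n))
    (x : Fin n → M) :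
    x ∈ simultaneousFixedPoints (Fin n → M) π ↔ ∀ j i, x (π j i) = x i := by
  constructor
  · intro h j i
    have := congrFun (h j) (π j i)
    change x ((π j)⁻¹ (π j i)) = _ at this
    rw [Equiv.Perm.inv_def, Equiv.symm_apply_apply] at this
    exact this.symm
  · intro h j
    funext i
    change x ((π j)⁻¹ i) = x i
    rw [← h j, Equiv.Perm.inv_def, Equiv.apply_symm_apply]

lemma reachable_tupleGraph {n m : ℕ} (π : Fin m → Equiv.Perm (Fin n)) (j : Fin m) (i : Fin n) :
    (tupleGraph π).Reachable i (π j i) := by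
  by_cases h : i = π j i
  · rw [← h]
  · exact SimpleGraph.Adj.reachable ((tupleGraph_adj π _ _).2 ⟨h, Or.inl ⟨j, rfl⟩⟩)

lemma eq_of_reachable_tupleGraph {M : Type u} {n m : ℕ} {π : Fin m → Equiv.Perm (Fin n)}
    {x : Fin n → M} (hx : x ∈ simultaneousFixedPoints (Fin n → M) π) {a b : Fin n}
    (h : (tupleGraph π).Reachable a b) : x a = x b := by
  rw [mem_simultaneousFixedPoints_iff] at hx
  obtain ⟨p⟩ := h
  induction p with
  | nil => rfl
  | cons hadj _ ih =>
    refine Eq.trans ?_ ih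
    obtain ⟨-, ⟨j, rfl⟩ | ⟨j, rfl⟩⟩ := (tupleGraph_adj π _ _).1 hadj
    · exact (hx j _).symm
    · exact hx j _

/-- The simultaneous fixed points of a tuple of permutations of the factors of a power are the
functions on the set of components. -/
def fixedPointsHomeomorph (M : Type u) [TopologicalSpace M] {n m : ℕ}
    (π : Fin m → Equiv.Perm (Fin n)) :
    ((tupleGraph π).ConnectedComponent → M) ≃ₜ simultaneousFixedPoints (Fin n → M) π where
  toFun y := ⟨fun i => y ((tupleGraph π).connectedComponentMk i), by
    rw [mem_simultaneousFixedPoints_iff]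
    intro j i
    rw [SimpleGraph.ConnectedComponent.sound (reachable_tupleGraph π j i)]⟩
  invFun x c := x.1 (Quot.out c)
  left_inv y := by
    funext c
    exact congrArg y (Quot.out_eq c)
  right_inv x := by
    apply Subtype.ext
    funext i
    exact eq_of_reachable_tupleGraph x.2
      (SimpleGraph.ConnectedComponent.exact (Quot.out_eq ((tupleGraph π).connectedComponentMk i)))
  continuous_toFun := by
    apply Continuous.subtype_mk
    exact continuous_pi fun i => continuous_apply _
  continuous_invFun := continuous_pi fun c => (continuous_apply _).comp continuous_subtype_val

/-- The fixed point set is a power of $M$ with one factor per component; evaluation at $-1$ will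
give $\chi^{\#(\pi)}$. -/
lemma IsPoincarePolynomial.fixedPoints {M : Type u} [TopologicalSpace M] {p : Polynomial ℕ}
    (hp : IsPoincarePolynomial M p) {n m : ℕ} (π : Fin m → Equiv.Perm (Fin n)) :
    IsPoincarePolynomial (simultaneousFixedPoints (Fin n → M) π) (p ^ numComponents π) := by
  let := Fintype.ofFinite (tupleGraph π).ConnectedComponent
  rw [numComponents, Nat.card_eq_fintype_card]
  exact hp.pi.congr (fixedPointsHomeomorph M π)

/-! ### Commuting tuples and homomorphisms from a free abelian group -/

/-- The free abelian group `ℤ ^ m`, written multiplicatively. -/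
abbrev IntPow (m : ℕ) : Type := Fin m → Multiplicative ℤ

/-- A commuting `m`-tuple is the same as a homomorphism from `ℤ ^ m`. -/
def commutingTupleEquiv (H : Type*) [Group H] (m : ℕ) :
    {g : Fin m → H // ∀ i j, Commute (g i) (g j)} ≃ (IntPow m →* H) :=
  ((Equiv.piCongrRight fun _ => zpowersHom H).subtypeEquiv (fun g => by
    constructor
    · intro h i j _ x y
      exact ((h i j).zpow_zpow _ _)
    · intro h i j
      -- A homomorphism from the product only asks distinct factors to commute; the diagonal case is
      -- automatic.
      by_cases hij : i = j
      · rw [hij]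
      · simpa using h hij (Multiplicative.ofAdd 1) (Multiplicative.ofAdd 1))).trans
    (MonoidHom.noncommPiCoprodEquiv (N := fun _ : Fin m => Multiplicative ℤ) (M := H))

lemma commutingTupleEquiv_mulSingle {H : Type*} [Group H] {m : ℕ}
    (g : {g : Fin m → H // ∀ i j, Commute (g i) (g j)}) (i : Fin m) :
    commutingTupleEquiv H m g (Pi.mulSingle i (Multiplicative.ofAdd 1)) = g.1 i := by
  have h : (commutingTupleEquiv H m g) (Pi.mulSingle i (Multiplicative.ofAdd 1)) =
      zpowersHom H (g.1 i) (Multiplicative.ofAdd 1) :=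
    MonoidHom.noncommPiCoprod_mulSingle (N := fun _ : Fin m => Multiplicative ℤ)
      (fun i => zpowersHom H (g.1 i)) (hcomm := fun i j _ x y => (g.2 i j).zpow_zpow _ _) i
      (Multiplicative.ofAdd 1)
  simp [h]

lemma commutingTupleEquiv_mem {H : Type*} [Group H] {m : ℕ}
    (g : {g : Fin m → H // ∀ i j, Commute (g i) (g j)}) (S : Subgroup H) (hS : ∀ i, g.1 i ∈ S)
    (v : IntPow m) : commutingTupleEquiv H m g v ∈ S :=
  Subgroup.noncommProd_mem S (t := Finset.univ) (f := fun i => zpowersHom H (g.1 i) (v i))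
    (fun i _ j _ _ => (g.2 i j).zpow_zpow _ _) fun i _ => S.zpow_mem (hS i) _

/-- The orbits of the action given by a homomorphism to a permutation group. -/
def orbitSetoid {G α : Type*} [Group G] (φ : G →* Equiv.Perm α) : Setoid α where
  r a b := ∃ g, φ g a = b
  iseqv :=
    { refl := fun a => ⟨1, by simp⟩
      symm := by
        rintro a b ⟨g, rfl⟩
        exact ⟨g⁻¹, by simp⟩
      trans := by
        rintro a b c ⟨g, rfl⟩ ⟨h, rfl⟩
        exact ⟨h * g, by simp⟩ }

/-- The number of orbits of the action given by a homomorphism to a permutation group. -/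
def numOrbits {G α : Type*} [Group G] (φ : G →* Equiv.Perm α) : ℕ :=
  Nat.card (Quotient (orbitSetoid φ))

lemma numOrbits_commutingTupleEquiv {n m : ℕ}
    (π : {g : Fin m → Equiv.Perm (Fin n) // ∀ i j, Commute (g i) (g j)}) :
    numOrbits (commutingTupleEquiv _ m π) = numComponents π.1 := by
  have key : ∀ a b, (orbitSetoid (commutingTupleEquiv _ m π)) a b ↔
      (tupleGraph π.1).Reachable a b := by
    intro a b
    constructor
    · rintro ⟨v, rfl⟩
      -- The permutations moving each point inside its component form a subgroup containing every
      -- $\pi_j$, hence the whole image of $\mathbf{Z}^m$.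
      let S : Subgroup (Equiv.Perm (Fin n)) :=
        { carrier := {σ | ∀ a, (tupleGraph π.1).Reachable a (σ a)}
          one_mem' := fun a => SimpleGraph.Reachable.refl _
          mul_mem' := fun {σ τ} hσ hτ a => (hτ a).trans (hσ (τ a))
          inv_mem' := fun {σ} hσ a => by simpa using (hσ (σ⁻¹ a)).symm }
      exact commutingTupleEquiv_mem π S (fun i a => reachable_tupleGraph _ _ _) v a
    · rintro ⟨p⟩
      induction p with
      | nil => exact Setoid.refl' _ _
      | cons hadj _ ih =>
        refine Setoid.trans' _ ?_ ih
        obtain ⟨-, ⟨j, rfl⟩ | ⟨j, rfl⟩⟩ := (tupleGraph_adj π.1 _ _).1 hadj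
        · exact ⟨_, by rw [commutingTupleEquiv_mulSingle]⟩
        · exact Setoid.symm' _ ⟨_, by rw [commutingTupleEquiv_mulSingle]⟩
  exact Nat.card_congr (Quot.congrRight key)

/-- A homomorphism is determined by its values on a finite generating set. -/
instance finite_monoidHom (G H : Type*) [Group G] [Group.FG G] [Group H] [Finite H] :
    Finite (G →* H) := by
  obtain ⟨S, hS⟩ := Group.FG.out (G := G)
  refine Finite.of_injective (fun (φ : G →* H) (s : S) => φ s) fun φ ψ h => ?_
  exact MonoidHom.eq_of_eqOn_dense hS fun s hs => congrFun h ⟨s, hs⟩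

noncomputable instance fintype_monoidHom (G H : Type*) [Group G] [Group.FG G] [Group H] [Finite H] :
    Fintype (G →* H) := Fintype.ofFinite _

instance (m : ℕ) : Group.FG (IntPow m) := inferInstance

/-- The sum over the actions of `G` on `α` of `x` to the number of orbits. -/
def orbitSum (G α : Type*) [Group G] [Group.FG G] [Finite α] (x : ℚ) : ℚ :=
  ∑ φ : G →* Equiv.Perm α, x ^ numOrbits φ

lemma sum_commutingTuples (n m : ℕ) (x : ℚ) :
    ∑ π ∈ commutingTuples (Equiv.Perm (Fin n)) m, x ^ numComponents π =
      orbitSum (IntPow m) (Fin n) x := by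
  classical
  rw [orbitSum, ← (commutingTupleEquiv (Equiv.Perm (Fin n)) m).sum_comp]
  simp only [numOrbits_commutingTupleEquiv]
  refine (Finset.sum_subtype _ (fun π => ?_) _)
  simp [commutingTuples]

end

noncomputable section

/-! ### Transitive actions and subgroups of finite index -/

/-- The number of subgroups of index `n`. -/
def subgroupCount (G : Type*) [Group G] (n : ℕ) : ℕ :=
  Nat.card {H : Subgroup G // H.index = n}

/-- The transitive actions of `G` on `α`. -/
abbrev TransitiveHom (G α : Type*) [Group G] : Type _ :=
  {φ : G →* Equiv.Perm α // ∀ a b, ∃ g, φ g a = b}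

section

variable {G α : Type*} [Group G]

/-- The action on `α` obtained by identifying it with a coset space. -/
def cosetHom (H : Subgroup G) (e : G ⧸ H ≃ α) : G →* Equiv.Perm α :=
  e.permCongrHom.toMonoidHom.comp (MulAction.toPermHom G (G ⧸ H))

lemma cosetHom_apply (H : Subgroup G) (e : G ⧸ H ≃ α) (g : G) (x : G ⧸ H) :
    cosetHom H e g (e x) = e (g • x) := by
  change e (g • e.symm (e x)) = _
  rw [Equiv.symm_apply_apply]

lemma cosetHom_apply_one (H : Subgroup G) (e : G ⧸ H ≃ α) (g : G) :
    cosetHom H e g (e (1 : G)) = e (g : G) := by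
  rw [cosetHom_apply, MulAction.Quotient.smul_coe, smul_eq_mul, mul_one]

/-- A transitive action with a base point from a subgroup and a labelling of its cosets. -/
def pointedTransitiveHom (x : Σ H : Subgroup G, (G ⧸ H ≃ α)) : TransitiveHom G α × α :=
  (⟨cosetHom x.1 x.2, by
    intro a b
    obtain ⟨c, rfl⟩ := x.2.surjective a
    obtain ⟨d, rfl⟩ := x.2.surjective b
    obtain ⟨c, rfl⟩ := QuotientGroup.mk_surjective c
    obtain ⟨d, rfl⟩ := QuotientGroup.mk_surjective d
    exact ⟨d * c⁻¹, by
      rw [cosetHom_apply, MulAction.Quotient.smul_coe, smul_eq_mul, inv_mul_cancel_right]⟩⟩,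
    x.2 (1 : G))

/-- The orbit-stabilizer theorem: the subgroup is recovered as the stabilizer of the base point, the
labelling as the orbit map. -/
lemma pointedTransitiveHom_bijective :
    Function.Bijective (pointedTransitiveHom (G := G) (α := α)) := by
  constructor
  · rintro ⟨H, e⟩ ⟨H', e'⟩ h
    have h1 : cosetHom H e = cosetHom H' e' := congrArg (fun z => z.1.1) h
    have h2 : e (1 : G) = e' (1 : G) := congrArg (fun z => z.2) h
    have h3 : ∀ g : G, e g = e' g := fun g => by
      rw [← cosetHom_apply_one H e g, ← cosetHom_apply_one H' e' g, h1, h2]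
    obtain rfl : H = H' := by
      ext g
      have k1 : g ∈ H ↔ e g = e (1 : G) := by
        rw [e.injective.eq_iff, eq_comm, QuotientGroup.eq, inv_one, one_mul]
      have k2 : g ∈ H' ↔ e' g = e' (1 : G) := by
        rw [e'.injective.eq_iff, eq_comm, QuotientGroup.eq, inv_one, one_mul]
      rw [k1, k2, h3, h3]
    congr 1
    ext x
    induction x using QuotientGroup.induction_on with
    | H g => exact h3 g
  · rintro ⟨⟨φ, hφ⟩, a⟩
    let : MulAction G α := MulAction.compHom α φ
    let e : G ⧸ MulAction.stabilizer G a ≃ α :=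
      Equiv.ofBijective (MulAction.ofQuotientStabilizer G a)
        ⟨MulAction.injective_ofQuotientStabilizer G a, fun b => by
          obtain ⟨g, hg⟩ := hφ a b
          exact ⟨(g : G), hg⟩⟩
    have he : ∀ g : G, e g = φ g a := fun g => rfl
    refine ⟨⟨_, e⟩, Prod.ext (Subtype.ext ?_) ?_⟩
    · change cosetHom _ e = φ
      ext g b
      obtain ⟨c, rfl⟩ := e.surjective b
      induction c using QuotientGroup.induction_on with
      | H c =>
        rw [cosetHom_apply, MulAction.Quotient.smul_coe, he, he, smul_eq_mul, map_mul]
        rfl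
    · change e (1 : G) = a
      rw [he, map_one]
      rfl

/-- Labelled cosets of subgroups whose index is the number of labels. -/
lemma sigma_cosets_bijective [Finite α] [Nonempty α] :
    Function.Bijective (fun x : Σ H : {H : Subgroup G // H.index = Nat.card α}, (G ⧸ H.1 ≃ α) =>
      (⟨x.1.1, x.2⟩ : Σ H : Subgroup G, (G ⧸ H ≃ α))) := by
  constructor
  · rintro ⟨⟨H, hH⟩, e⟩ ⟨⟨H', hH'⟩, e'⟩ h
    obtain ⟨rfl, h⟩ := Sigma.mk.inj_iff.1 h
    obtain rfl := eq_of_heq h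
    rfl
  · rintro ⟨H, e⟩
    exact ⟨⟨⟨H, Nat.card_congr e⟩, e⟩, rfl⟩

lemma nonempty_cosets_equiv [Finite α] [Nonempty α]
    (H : {H : Subgroup G // H.index = Nat.card α}) : Nonempty (G ⧸ H.1 ≃ α) := by
  have : H.1.FiniteIndex := ⟨by rw [H.2]; exact Nat.card_pos.ne'⟩
  exact Finite.card_eq.1 H.2

/-- Labelling the cosets realizes each such subgroup in a pointed transitive action on $n$ points,
and there are finitely many of these. -/
lemma finite_subgroup_index [Group.FG G] {n : ℕ} (hn : n ≠ 0) :
    Finite {H : Subgroup G // H.index = n} := by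
  obtain ⟨n, rfl⟩ := Nat.exists_eq_add_one_of_ne_zero hn
  have hb := (pointedTransitiveHom_bijective (G := G) (α := Fin (n + 1))).comp
    sigma_cosets_bijective
  have := Finite.of_injective _ hb.1
  rw [← Nat.card_fin (n + 1)]
  refine Finite.of_surjective
    (fun x : Σ H : {H : Subgroup G // H.index = Nat.card (Fin (n + 1))}, (G ⧸ H.1 ≃ Fin (n + 1)) =>
      x.1) fun H => ?_
  obtain ⟨e⟩ := nonempty_cosets_equiv H
  exact ⟨⟨H, e⟩, rfl⟩

/-- Pairs of a transitive action and a base point are counted twice: $n+1$ base points per action,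
and $(n+1)!$ labellings per subgroup. -/
lemma card_transitiveHom [Group.FG G] (n : ℕ) :
    Nat.card (TransitiveHom G (Fin (n + 1))) = n.factorial * subgroupCount G (n + 1) := by
  have hb := (pointedTransitiveHom_bijective (G := G) (α := Fin (n + 1))).comp
    sigma_cosets_bijective
  have h := Nat.card_congr (Equiv.ofBijective _ hb)
  have hfin : Finite {H : Subgroup G // H.index = Nat.card (Fin (n + 1))} :=
    finite_subgroup_index Nat.card_pos.ne'
  let := Fintype.ofFinite {H : Subgroup G // H.index = Nat.card (Fin (n + 1))}
  have hf : ∀ H : {H : Subgroup G // H.index = Nat.card (Fin (n + 1))},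
      Finite (G ⧸ H.1 ≃ Fin (n + 1)) ∧
      Nat.card (G ⧸ H.1 ≃ Fin (n + 1)) = (n + 1).factorial := fun H => by
    obtain ⟨e⟩ := nonempty_cosets_equiv H
    have k := Equiv.equivCongr e (Equiv.refl (Fin (n + 1)))
    refine ⟨Finite.of_equiv _ k.symm, ?_⟩
    rw [Nat.card_congr k, Nat.card_eq_fintype_card, Fintype.card_perm, Fintype.card_fin]
  have := fun H => (hf H).1
  rw [Nat.card_sigma, Finset.sum_congr rfl fun H _ => (hf H).2, Finset.sum_const, Finset.card_univ,
    Nat.card_prod, ← Nat.card_eq_fintype_card, ← subgroupCount, Nat.card_fin, smul_eq_mul,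
    Nat.factorial_succ] at h
  have h' : Nat.card (TransitiveHom G (Fin (n + 1))) * (n + 1) =
      (n.factorial * subgroupCount G (n + 1)) * (n + 1) := by
    rw [← h]
    ring
  exact Nat.eq_of_mul_eq_mul_right n.succ_pos h'

end

end

noncomputable section

/-! ### Subgroups of a product with an infinite cyclic group -/

section

/-- Factor the index through $L\cdot G$: the step from $L$ is measured by $L\cap G$, the remaining
one by the image in $A$. -/
lemma Subgroup.index_prod_eq {G A : Type*} [CommGroup G] [CommGroup A] (L : Subgroup (G × A)) :
    L.index = (L.comap (MonoidHom.inl G A)).index * (L.map (MonoidHom.snd G A)).index := by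
  have hr : (MonoidHom.inl G A).range = (MonoidHom.snd G A).ker := by
    ext ⟨g, a⟩
    simp only [MonoidHom.mem_range, MonoidHom.mem_ker, MonoidHom.inl_apply, Prod.mk.injEq,
      MonoidHom.coe_snd]
    exact ⟨fun ⟨_, _, h⟩ => h.symm, fun h => ⟨g, rfl, h.symm⟩⟩
  have hs : (MonoidHom.snd G A).range = ⊤ := MonoidHom.range_eq_top.2 Prod.snd_surjective
  rw [Subgroup.index_comap, Subgroup.index_map, hr, hs, Subgroup.index_top, mul_one,
    ← Subgroup.relIndex_mul_index (show L ≤ L ⊔ (MonoidHom.snd G A).ker from le_sup_left)]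
  congr 1
  rw [sup_comm, Subgroup.relIndex_sup_right]

lemma index_zpowers_ofAdd (e : ℕ) :
    (Subgroup.zpowers (Multiplicative.ofAdd (e : ℤ))).index = e := by
  have h := Int.index_zmultiples (e : ℤ)
  rw [Int.natAbs_natCast] at h
  rw [← AddSubgroup.index_toSubgroup] at h
  exact h

/-- A generator is unique up to sign and its absolute value is the index. The convention that
infinite index is $0$ covers the trivial subgroup. -/
lemma eq_zpowers_index (L : Subgroup (Multiplicative ℤ)) :
    L = Subgroup.zpowers (Multiplicative.ofAdd (L.index : ℤ)) := by
  obtain ⟨a, rfl⟩ := Subgroup.isCyclic_iff_exists_zpowers_eq_top L |>.1 inferInstance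
  have : Subgroup.zpowers a = Subgroup.zpowers (Multiplicative.ofAdd ((a.toAdd.natAbs : ℕ) : ℤ)) := by
    rcases Int.natAbs_eq a.toAdd with h | h
    · rw [← h]; rfl
    · rw [← Subgroup.zpowers_inv]
      congr 1
      rw [← ofAdd_toAdd a, h]
      simp
  rw [this, index_zpowers_ofAdd]

end

section

variable {G : Type*} [CommGroup G]

/-- The subgroup of `G × ℤ` generated by `K × 0` and a lift of `(w, e)`. -/
def cyclicExtension (K : Subgroup G) (e : ℕ) (w : G ⧸ K) : Subgroup (G × Multiplicative ℤ) :=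
  (Subgroup.zpowers (w, Multiplicative.ofAdd (e : ℤ))).comap
    ((QuotientGroup.mk' K).prodMap (MonoidHom.id (Multiplicative ℤ)))

lemma mem_cyclicExtension (K : Subgroup G) (e : ℕ) (w : G ⧸ K) (g : G) (t : ℤ) :
    (g, Multiplicative.ofAdd t) ∈ cyclicExtension K e w ↔ ∃ j : ℤ, w ^ j = g ∧ j * e = t := by
  rw [cyclicExtension, Subgroup.mem_comap, Subgroup.mem_zpowers_iff]
  refine exists_congr fun j => ?_
  rw [Prod.ext_iff]
  refine and_congr Iff.rfl ?_
  change (Multiplicative.ofAdd (e : ℤ)) ^ j = Multiplicative.ofAdd t ↔ _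
  rw [← ofAdd_zsmul, Multiplicative.ofAdd.injective.eq_iff, smul_eq_mul]

lemma comap_inl_cyclicExtension (K : Subgroup G) {e : ℕ} (he : e ≠ 0) (w : G ⧸ K) :
    (cyclicExtension K e w).comap (MonoidHom.inl G (Multiplicative ℤ)) = K := by
  ext g
  refine (mem_cyclicExtension K e w g 0).trans ?_
  constructor
  · rintro ⟨j, hj, h⟩
    obtain rfl : j = 0 := by simpa [he] using h
    rw [zpow_zero] at hj
    exact (QuotientGroup.eq_one_iff g).1 hj.symm
  · intro hg
    exact ⟨0, by rw [zpow_zero, (QuotientGroup.eq_one_iff g).2 hg], by simp⟩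

lemma map_snd_cyclicExtension (K : Subgroup G) (e : ℕ) (w : G ⧸ K) :
    (cyclicExtension K e w).map (MonoidHom.snd G (Multiplicative ℤ)) =
      Subgroup.zpowers (Multiplicative.ofAdd (e : ℤ)) := by
  ext t
  rw [Subgroup.mem_map, Subgroup.mem_zpowers_iff]
  constructor
  · rintro ⟨⟨g, s⟩, h, rfl⟩
    obtain ⟨j, -, hj⟩ := (mem_cyclicExtension K e w g s.toAdd).1 h
    refine ⟨j, ?_⟩
    rw [← ofAdd_zsmul, smul_eq_mul, hj]
    rfl
  · rintro ⟨j, rfl⟩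
    obtain ⟨g, hg⟩ := QuotientGroup.mk_surjective (w ^ j)
    refine ⟨(g, Multiplicative.ofAdd (j * e)), (mem_cyclicExtension K e w g _).2 ⟨j, hg.symm, rfl⟩, ?_⟩
    rw [← ofAdd_zsmul, smul_eq_mul]
    rfl

/-- Lift the generator of the projection to $\mathbf{Z}$ to an element of $L$; only its class modulo
$L\cap G$ matters. -/
lemma exists_cyclicExtension_eq (L : Subgroup (G × Multiplicative ℤ)) :
    ∃ w, cyclicExtension (L.comap (MonoidHom.inl G (Multiplicative ℤ)))
      (L.map (MonoidHom.snd G (Multiplicative ℤ))).index w = L := by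
  set K := L.comap (MonoidHom.inl G (Multiplicative ℤ)) with hK
  set e := (L.map (MonoidHom.snd G (Multiplicative ℤ))).index with he
  have hmap := eq_zpowers_index (L.map (MonoidHom.snd G (Multiplicative ℤ)))
  rw [← he] at hmap
  have hmem : Multiplicative.ofAdd (e : ℤ) ∈ L.map (MonoidHom.snd G (Multiplicative ℤ)) := by
    rw [hmap]
    exact Subgroup.mem_zpowers _
  obtain ⟨⟨g, s⟩, hg, rfl : s = _⟩ := hmem
  have hpow : ∀ j : ℤ, (g ^ j, Multiplicative.ofAdd (j * e)) ∈ L := fun j => by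
    have := L.zpow_mem hg j
    rwa [Prod.pow_mk, ← ofAdd_zsmul, smul_eq_mul] at this
  -- The elements of $L$ over $je$ form the coset of $L\cap G$ through $g^j$.
  have hiff : ∀ (x : G) (j : ℤ), (x, Multiplicative.ofAdd (j * e)) ∈ L ↔ (g : G ⧸ K) ^ j = x := by
    intro x j
    have key : (g ^ j, Multiplicative.ofAdd (j * (e : ℤ))) *
        MonoidHom.inl G (Multiplicative ℤ) ((g ^ j)⁻¹ * x) =
        (x, Multiplicative.ofAdd (j * (e : ℤ))) := by
      rw [MonoidHom.inl_apply, Prod.mk_mul_mk, mul_one, mul_inv_cancel_left]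
    rw [← QuotientGroup.mk_zpow, QuotientGroup.eq, hK, Subgroup.mem_comap, ← key,
      L.mul_mem_cancel_left (hpow j)]
  refine ⟨g, ?_⟩
  ext ⟨x, t⟩
  refine (mem_cyclicExtension K e _ x t.toAdd).trans ⟨?_, fun h => ?_⟩
  · rintro ⟨j, hj, ht⟩
    have := (hiff x j).2 hj
    rwa [ht] at this
  · have ht : t ∈ L.map (MonoidHom.snd G (Multiplicative ℤ)) := ⟨_, h, rfl⟩
    rw [hmap, Subgroup.mem_zpowers_iff] at ht
    obtain ⟨j, rfl⟩ := ht
    refine ⟨j, (hiff x j).1 ?_, ?_⟩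
    · rwa [← ofAdd_zsmul, smul_eq_mul] at h
    · rw [← ofAdd_zsmul, smul_eq_mul]
      rfl

variable (G) in
/-- Subgroups of index `n` of `G × ℤ` in terms of the subgroups of `G`. -/
def cyclicExtensionMap {n : ℕ} (hn : n ≠ 0)
    (x : Σ d : n.divisors, Σ K : {K : Subgroup G // K.index = d}, G ⧸ K.1) :
    {L : Subgroup (G × Multiplicative ℤ) // L.index = n} :=
  ⟨cyclicExtension x.2.1.1 (n / x.1) x.2.2, by
    have hd := Nat.dvd_of_mem_divisors x.1.2
    have he : n / (x.1 : ℕ) ≠ 0 := (Nat.div_pos (Nat.le_of_dvd (Nat.pos_of_ne_zero hn) hd)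
      (Nat.pos_of_mem_divisors x.1.2)).ne'
    rw [Subgroup.index_prod_eq, comap_inl_cyclicExtension _ he, map_snd_cyclicExtension,
      index_zpowers_ofAdd, x.2.1.2, Nat.mul_div_cancel' hd]⟩

variable (G) in
lemma cyclicExtensionMap_bijective {n : ℕ} (hn : n ≠ 0) :
    Function.Bijective (cyclicExtensionMap G hn) := by
  have hdiv : ∀ d : n.divisors, n / (d : ℕ) ≠ 0 := fun d =>
    (Nat.div_pos (Nat.le_of_dvd (Nat.pos_of_ne_zero hn) (Nat.dvd_of_mem_divisors d.2))
      (Nat.pos_of_mem_divisors d.2)).ne'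
  constructor
  · rintro ⟨⟨d, hd⟩, ⟨K, hK : K.index = d⟩, w⟩ ⟨⟨d', hd'⟩, ⟨K', hK' : K'.index = d'⟩, w'⟩ h
    have h : cyclicExtension K (n / d) w = cyclicExtension K' (n / d') w' := congrArg Subtype.val h
    obtain rfl : K = K' := by
      rw [← comap_inl_cyclicExtension K (hdiv ⟨d, hd⟩) w,
        ← comap_inl_cyclicExtension K' (hdiv ⟨d', hd'⟩) w', h]
    subst hK hK'
    obtain ⟨g, rfl⟩ := QuotientGroup.mk_surjective w
    have hg : (g, Multiplicative.ofAdd (((n / K.index : ℕ) : ℤ))) ∈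
        cyclicExtension K (n / K.index) (g : G ⧸ K) :=
      (mem_cyclicExtension _ _ _ _ _).2 ⟨1, by rw [zpow_one], by rw [one_mul]⟩
    rw [h, mem_cyclicExtension] at hg
    obtain ⟨j, hj, h1⟩ := hg
    have hne := hdiv ⟨_, hd⟩
    obtain rfl : j = 1 := by
      have : ((n / K.index : ℕ) : ℤ) ≠ 0 := by exact_mod_cast hne
      exact mul_right_cancel₀ this (h1.trans (one_mul _).symm)
    rw [zpow_one] at hj
    rw [hj]
  · rintro ⟨L, hL⟩
    obtain ⟨w, hw⟩ := exists_cyclicExtension_eq L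
    have hi := L.index_prod_eq
    rw [hL] at hi
    have hpos : (L.comap (MonoidHom.inl G (Multiplicative ℤ))).index ≠ 0 := by
      intro h0
      rw [h0, zero_mul] at hi
      exact hn hi
    refine ⟨⟨⟨_, Nat.mem_divisors.2 ⟨⟨_, hi⟩, hn⟩⟩, ⟨_, rfl⟩, w⟩, Subtype.ext ?_⟩
    refine Eq.trans ?_ hw
    change cyclicExtension _ (n / _) w = _
    congr 1
    exact Nat.div_eq_of_eq_mul_right (Nat.pos_of_ne_zero hpos) hi

/-- A subgroup of index $n$ is given by its intersection $K$ with $G$, of index $d\mid n$, and a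
class in $G/K$, for which there are $d$ choices; its projection to $\mathbf{Z}$ has index $n/d$. -/
lemma subgroupCount_prod [Group.FG G] {n : ℕ} (hn : n ≠ 0) :
    subgroupCount (G × Multiplicative ℤ) n = ∑ d ∈ n.divisors, d * subgroupCount G d := by
  have hfin : ∀ d : n.divisors, Finite {K : Subgroup G // K.index = d} := fun d =>
    finite_subgroup_index (Nat.pos_of_mem_divisors d.2).ne'
  have hq : ∀ (d : n.divisors) (K : {K : Subgroup G // K.index = d}), Finite (G ⧸ K.1) :=
    fun d K => by
      have : K.1.FiniteIndex := ⟨by rw [K.2]; exact (Nat.pos_of_mem_divisors d.2).ne'⟩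
      infer_instance
  let := fun d : n.divisors => Fintype.ofFinite {K : Subgroup G // K.index = d}
  rw [subgroupCount, ← Nat.card_congr (Equiv.ofBijective _ (cyclicExtensionMap_bijective G hn)),
    Nat.card_sigma, ← Finset.sum_coe_sort n.divisors]
  refine Finset.sum_congr rfl fun d _ => ?_
  rw [Nat.card_sigma, Finset.sum_congr rfl (fun K _ => (show Nat.card (G ⧸ K.1) = d from K.2)),
    Finset.sum_const, Finset.card_univ, ← Nat.card_eq_fintype_card, smul_eq_mul, mul_comm]
  rfl

end

lemma subgroupCount_congr {G H : Type*} [Group G] [Group H] (e : G ≃* H) (n : ℕ) :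
    subgroupCount G n = subgroupCount H n :=
  Nat.card_congr (e.mapSubgroup.toEquiv.subtypeEquiv fun K => by
    change _ ↔ (K.map (e : G →* H)).index = n
    rw [Subgroup.index_map_equiv])

lemma subgroupCount_of_subsingleton (G : Type*) [Group G] [Subsingleton G] (n : ℕ) :
    subgroupCount G n = if n = 1 then 1 else 0 := by
  have h : ∀ H : Subgroup G, H.index = 1 := fun H => by
    rw [Subgroup.index_eq_one]
    exact Subsingleton.elim _ _
  split_ifs with hn
  · subst hn
    rw [subgroupCount, Nat.card_congr (Equiv.subtypeUnivEquiv h), Nat.card_unique]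
  · rw [subgroupCount, Nat.card_eq_zero]
    exact Or.inl ⟨fun H => hn (by rw [← H.2, h])⟩

/-- Splitting off the last coordinate. -/
def intPowSuccEquiv (m : ℕ) : IntPow (m + 1) ≃* IntPow m × Multiplicative ℤ where
  toFun v := (fun i => v i.castSucc, v (Fin.last m))
  invFun p := Fin.snoc p.1 p.2
  left_inv v := Fin.snoc_init_self v
  right_inv p := by simp
  map_mul' _ _ := rfl

lemma subgroupCount_intPow_succ (m : ℕ) {n : ℕ} (hn : n ≠ 0) :
    subgroupCount (IntPow (m + 1)) n = ∑ d ∈ n.divisors, d * subgroupCount (IntPow m) d := by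
  rw [subgroupCount_congr (intPowSuccEquiv m), subgroupCount_prod hn]

/-! ### Factorizations -/

lemma finite_setOf_prod_eq (k : ℕ) {n : ℕ} (hn : n ≠ 0) :
    {i : Fin k → ℕ+ | ∏ j, (i j : ℕ) = n}.Finite := by
  refine (Set.Finite.pi' (t := fun _ : Fin k => Set.Iic (⟨n, Nat.pos_of_ne_zero hn⟩ : ℕ+))
    fun _ => Set.finite_Iic _).subset ?_
  rintro i rfl j
  exact Nat.le_of_dvd (Nat.pos_of_ne_zero hn) (Finset.dvd_prod_of_mem _ (Finset.mem_univ j))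

open Classical in
/-- The factorizations of `n ≠ 0` into `k` factors. -/
def factorizations (k n : ℕ) : Finset (Fin k → ℕ+) :=
  if hn : n ≠ 0 then (finite_setOf_prod_eq k hn).toFinset else ∅

lemma mem_factorizations {k n : ℕ} (hn : n ≠ 0) (i : Fin k → ℕ+) :
    i ∈ factorizations k n ↔ ∏ j, (i j : ℕ) = n := by
  simp [factorizations, hn]

/-- The weight `i₁ ^ (k - 1) * i₂ ^ (k - 2) * ⋯` of a tuple. -/
def tupleWeight {k : ℕ} (i : Fin k → ℕ+) : ℕ :=
  ∏ j, (i j : ℕ) ^ (k - 1 - (j : ℕ))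

lemma tupleWeight_succ {k : ℕ} (i : Fin (k + 1) → ℕ+) :
    tupleWeight i = (∏ j : Fin k, (i j.castSucc : ℕ)) * tupleWeight (fun j => i j.castSucc) := by
  rw [tupleWeight, Fin.prod_univ_castSucc, tupleWeight, ← Finset.prod_mul_distrib]
  simp only [Fin.val_castSucc, Fin.val_last, Nat.add_sub_cancel, Nat.sub_self, pow_zero, mul_one]
  refine Finset.prod_congr rfl fun j _ => ?_
  rw [← pow_succ']
  congr 1
  have := j.2
  omega

/-- Iterate the divisor recursion: $d$ is the product of the first $k$ factors and $n/d$ the last.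
The factor $d$ raises each earlier exponent in the weight by one. -/
lemma subgroupCount_intPow (k : ℕ) {n : ℕ} (hn : n ≠ 0) :
    subgroupCount (IntPow k) n = ∑ i ∈ factorizations k n, tupleWeight i := by
  induction k generalizing n with
  | zero =>
    rw [subgroupCount_of_subsingleton]
    split_ifs with h
    · have : factorizations 0 n = Finset.univ := by
        ext i
        subst h
        simpa [mem_factorizations] using Subsingleton.elim _ _
      simp [this, tupleWeight]
    · have : factorizations 0 n = ∅ := by
        ext i
        simp [mem_factorizations hn, Ne.symm h]
      simp [this]
  | succ k ih =>
    rw [subgroupCount_intPow_succ k hn]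
    rw [Finset.sum_congr rfl fun d hd => by
      rw [ih (Nat.pos_of_mem_divisors hd).ne', Finset.mul_sum]]
    rw [Finset.sum_sigma']
    have hdiv : ∀ {d : ℕ}, d ∈ n.divisors → 0 < n / d := fun {d} hd =>
      Nat.div_pos (Nat.le_of_dvd (Nat.pos_of_ne_zero hn) (Nat.dvd_of_mem_divisors hd))
        (Nat.pos_of_mem_divisors hd)
    refine Finset.sum_bij'
      (fun x _ => Fin.snoc (α := fun _ => ℕ+) x.2 (n / x.1).toPNat')
      (fun i _ => ⟨∏ j : Fin k, (i j.castSucc : ℕ), fun j => i j.castSucc⟩) ?_ ?_ ?_ ?_ ?_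
    · rintro ⟨d, i⟩ hx
      obtain ⟨hd, hi⟩ := Finset.mem_sigma.1 hx
      rw [mem_factorizations (Nat.pos_of_mem_divisors hd).ne'] at hi
      rw [mem_factorizations hn, Fin.prod_univ_castSucc]
      simp only [Fin.snoc_castSucc, Fin.snoc_last, Nat.toPNat'_coe] at hi ⊢
      rw [hi, if_pos (hdiv hd), Nat.mul_div_cancel' (Nat.dvd_of_mem_divisors hd)]
    · intro i hi
      rw [mem_factorizations hn, Fin.prod_univ_castSucc] at hi
      have hd : ∏ j : Fin k, (i j.castSucc : ℕ) ∈ n.divisors :=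
        Nat.mem_divisors.2 ⟨⟨_, hi.symm⟩, hn⟩
      exact Finset.mem_sigma.2
        ⟨hd, (mem_factorizations (Nat.pos_of_mem_divisors hd).ne' _).2 rfl⟩
    · rintro ⟨d, i⟩ hx
      obtain ⟨hd, hi⟩ := Finset.mem_sigma.1 hx
      rw [mem_factorizations (Nat.pos_of_mem_divisors hd).ne'] at hi
      simp only [Fin.snoc_castSucc] at hi ⊢
      rw [hi]
    · intro i hi
      rw [mem_factorizations hn, Fin.prod_univ_castSucc] at hi
      refine funext fun j => ?_
      induction j using Fin.lastCases with
      | last =>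
        refine (Fin.snoc_last _ _).trans ?_
        rw [Nat.div_eq_of_eq_mul_right (Finset.prod_pos fun j _ => PNat.pos _) hi.symm,
          PNat.coe_toPNat']
      | cast j => rw [Fin.snoc_castSucc]
    · rintro ⟨d, i⟩ hx
      obtain ⟨hd, hi⟩ := Finset.mem_sigma.1 hx
      rw [mem_factorizations (Nat.pos_of_mem_divisors hd).ne'] at hi
      rw [tupleWeight_succ]
      simp only [Fin.snoc_castSucc] at hi ⊢
      rw [hi]

end

noncomputable section

/-! ### The exponential recursion for actions on finite sets -/

section

variable {G α β : Type*} [Group G]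

/-- Renaming the points of an action. -/
def renameHom (e : α ≃ β) : (G →* Equiv.Perm α) ≃ (G →* Equiv.Perm β) where
  toFun φ := e.permCongrHom.toMonoidHom.comp φ
  invFun φ := e.permCongrHom.symm.toMonoidHom.comp φ
  left_inv φ := by
    ext g : 1
    exact e.permCongrHom.symm_apply_apply _
  right_inv φ := by
    ext g : 1
    exact e.permCongrHom.apply_symm_apply _

lemma renameHom_apply (e : α ≃ β) (φ : G →* Equiv.Perm α) (g : G) (a : α) :
    renameHom e φ g (e a) = e (φ g a) := by
  change e (φ g (e.symm (e a))) = _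
  rw [Equiv.symm_apply_apply]

lemma numOrbits_renameHom (e : α ≃ β) (φ : G →* Equiv.Perm α) :
    numOrbits (renameHom e φ) = numOrbits φ := by
  refine (Nat.card_congr (Quotient.congr e fun a b => ?_)).symm
  change (∃ g, _) ↔ ∃ g, _
  refine exists_congr fun g => ?_
  rw [renameHom_apply, e.injective.eq_iff]

lemma orbitSum_congr [Group.FG G] [Finite α] [Finite β] (e : α ≃ β) (x : ℚ) :
    orbitSum G α x = orbitSum G β x :=
  Fintype.sum_equiv (renameHom e) _ _ fun φ => by rw [numOrbits_renameHom]

lemma card_transitiveHom_congr (e : α ≃ β) :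
    Nat.card (TransitiveHom G α) = Nat.card (TransitiveHom G β) := by
  refine Nat.card_congr ((renameHom e).subtypeEquiv fun φ => ?_)
  refine e.forall_congr fun {a} => e.forall_congr fun {b} => exists_congr fun g => ?_
  rw [renameHom_apply, e.injective.eq_iff]

variable (p : α → Prop) [DecidablePred p]

/-- The disjoint union of two actions. -/
def unionHom (ψ : (G →* Equiv.Perm {a // p a}) × (G →* Equiv.Perm {a // ¬ p a})) :
    G →* Equiv.Perm α :=
  (Equiv.Perm.subtypeCongrHom p).comp (ψ.1.prod ψ.2)

variable {p}

lemma unionHom_apply_left (ψ : (G →* Equiv.Perm {a // p a}) × (G →* Equiv.Perm {a // ¬ p a}))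
    (g : G) (a : {a // p a}) : unionHom p ψ g a = ψ.1 g a :=
  Equiv.Perm.subtypeCongr.left_apply_subtype _ _ a

lemma unionHom_apply_right (ψ : (G →* Equiv.Perm {a // p a}) × (G →* Equiv.Perm {a // ¬ p a}))
    (g : G) (a : {a // ¬ p a}) : unionHom p ψ g a = ψ.2 g a :=
  Equiv.Perm.subtypeCongr.right_apply_subtype _ _ a

lemma unionHom_apply_iff (ψ : (G →* Equiv.Perm {a // p a}) × (G →* Equiv.Perm {a // ¬ p a}))
    (g : G) (a : α) : p (unionHom p ψ g a) ↔ p a := by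
  by_cases h : p a
  · rw [unionHom_apply_left ψ g ⟨a, h⟩]
    exact iff_of_true (Subtype.prop _) h
  · rw [unionHom_apply_right ψ g ⟨a, h⟩]
    exact iff_of_false (ψ.2 g ⟨a, h⟩).2 h

lemma unionHom_injective : Function.Injective (unionHom (G := G) p) := by
  intro ψ ψ' h
  refine Prod.ext ?_ ?_
  · ext g a
    rw [← unionHom_apply_left, ← unionHom_apply_left, h]
  · ext g a
    rw [← unionHom_apply_right, ← unionHom_apply_right, h]

lemma exists_unionHom_eq (φ : G →* Equiv.Perm α) (hφ : ∀ g a, p (φ g a) ↔ p a) :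
    ∃ ψ, unionHom p ψ = φ := by
  refine ⟨(⟨⟨fun g => (φ g).subtypePerm fun a => hφ g a, ?_⟩, ?_⟩,
    ⟨⟨fun g => (φ g).subtypePerm fun a => not_congr (hφ g a), ?_⟩, ?_⟩), ?_⟩
  · ext a; simp
  · intro g h; ext a; exact congrArg (fun σ : Equiv.Perm α => σ a) (map_mul φ g h)
  · ext a; simp
  · intro g h; ext a; exact congrArg (fun σ : Equiv.Perm α => σ a) (map_mul φ g h)
  · ext g a
    by_cases h : p a
    · exact unionHom_apply_left _ g ⟨a, h⟩
    · exact unionHom_apply_right _ g ⟨a, h⟩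

/-- The part where $p$ holds is a single orbit, represented by `none`. -/
lemma numOrbits_unionHom [Finite α]
    (ψ : (G →* Equiv.Perm {a // p a}) × (G →* Equiv.Perm {a // ¬ p a})) (a₀ : {a // p a})
    (h : ∀ a b, ∃ g, ψ.1 g a = b) : numOrbits (unionHom p ψ) = numOrbits ψ.2 + 1 := by
  let f : Option (Quotient (orbitSetoid ψ.2)) → Quotient (orbitSetoid (unionHom p ψ)) := fun o =>
    o.elim (Quotient.mk _ a₀.1) (Quotient.map Subtype.val (by
      rintro a b ⟨g, rfl⟩
      exact ⟨g, unionHom_apply_right ψ g a⟩))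
  have hne : ∀ (b : {a // ¬ p a}), ¬ (orbitSetoid (unionHom p ψ)) a₀.1 b.1 := by
    rintro b ⟨g, hg⟩
    exact b.2 (hg ▸ (unionHom_apply_iff ψ g a₀.1).2 a₀.2)
  have hf : Function.Bijective f := by
    constructor
    · rintro (_ | ⟨⟨b⟩⟩) (_ | ⟨⟨b'⟩⟩) hb
      · rfl
      · exact absurd (Quotient.exact hb) (hne b')
      · exact absurd (Quotient.exact hb.symm) (hne b)
      · obtain ⟨g, hg⟩ := Quotient.exact hb
        refine congrArg some (Quotient.sound ⟨g, Subtype.ext ?_⟩)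
        rw [← hg]
        exact (unionHom_apply_right ψ g b).symm
    · rintro ⟨a⟩
      by_cases ha : p a
      · obtain ⟨g, hg⟩ := h a₀ ⟨a, ha⟩
        refine ⟨none, Quotient.sound ⟨g, ?_⟩⟩
        rw [unionHom_apply_left, hg]
      · exact ⟨some (Quotient.mk _ ⟨a, ha⟩), rfl⟩
  rw [numOrbits, numOrbits, ← Nat.card_congr (Equiv.ofBijective f hf), Finite.card_option]

/-- An action for which `p` is the orbit of `a₀` is the union of a transitive action on `p` and
any action on the complement. -/
lemma unionHom_bijective (a₀ : {a // p a}) :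
    Function.Bijective (fun ψ : TransitiveHom G {a // p a} × (G →* Equiv.Perm {a // ¬ p a}) =>
      (⟨unionHom p (ψ.1.1, ψ.2), fun a => ⟨fun ha => by
          obtain ⟨g, hg⟩ := ψ.1.2 a₀ ⟨a, ha⟩
          exact ⟨g, by rw [unionHom_apply_left, hg]⟩, by
          rintro ⟨g, rfl⟩
          exact (unionHom_apply_iff _ g _).2 a₀.2⟩⟩ :
        {φ : G →* Equiv.Perm α // ∀ a, p a ↔ ∃ g, φ g a₀ = a})) := by
  constructor
  · rintro ⟨⟨ψ₁, h₁⟩, ψ₂⟩ ⟨⟨ψ₁', h₁'⟩, ψ₂'⟩ h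
    have h := unionHom_injective (congrArg Subtype.val h)
    obtain ⟨rfl, rfl⟩ := Prod.mk.inj h
    rfl
  · rintro ⟨φ, hφ⟩
    have hinv : ∀ g a, p a → p (φ g a) := fun g a ha => by
      obtain ⟨k, rfl⟩ := (hφ a).1 ha
      exact (hφ _).2 ⟨g * k, by rw [map_mul]; rfl⟩
    obtain ⟨ψ, rfl⟩ := exists_unionHom_eq (p := p) φ fun g a => ⟨fun h => by
      have := hinv g⁻¹ _ h
      rwa [← Equiv.Perm.mul_apply, ← map_mul, inv_mul_cancel, map_one] at this, hinv g a⟩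
    refine ⟨(⟨ψ.1, fun a b => ?_⟩, ψ.2), rfl⟩
    have key : ∀ a : {a // p a}, ∃ g, ψ.1 g a₀ = a := fun a => by
      obtain ⟨g, hg⟩ := (hφ a).1 a.2
      exact ⟨g, Subtype.ext (by rw [← hg, unionHom_apply_left])⟩
    obtain ⟨g, rfl⟩ := key a
    obtain ⟨h, rfl⟩ := key b
    exact ⟨h * g⁻¹, by rw [← Equiv.Perm.mul_apply, ← map_mul, inv_mul_cancel_right]⟩

lemma sum_unionHom [Group.FG G] [Finite α] (a₀ : {a // p a}) (x : ℚ)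
    [Fintype {φ : G →* Equiv.Perm α // ∀ a, p a ↔ ∃ g, φ g a₀ = a}] :
    ∑ φ : {φ : G →* Equiv.Perm α // ∀ a, p a ↔ ∃ g, φ g a₀ = a}, x ^ numOrbits φ.1 =
      x * Nat.card (TransitiveHom G {a // p a}) * orbitSum G {a // ¬ p a} x := by
  let := Fintype.ofFinite (TransitiveHom G {a // p a})
  rw [← (Equiv.ofBijective _ (unionHom_bijective (G := G) a₀)).sum_comp, Fintype.sum_prod_type]
  have h : ∀ (ψ : TransitiveHom G {a // p a}) (ψ' : G →* Equiv.Perm {a // ¬ p a}),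
      x ^ numOrbits (unionHom p (ψ.1, ψ')) = x ^ numOrbits ψ' * x := fun ψ ψ' => by
    rw [numOrbits_unionHom _ a₀ ψ.2, pow_succ]
  simp only [Equiv.ofBijective_apply, h]
  rw [Finset.sum_const, ← Finset.sum_mul, Finset.card_univ, Nat.card_eq_fintype_card, nsmul_eq_mul,
    orbitSum]
  ring

end

/-- Sort the actions by the orbit of $0$: choose its other $k$ points, a transitive action on it,
and any action on the complement. -/
lemma orbitSum_succ (G : Type*) [Group G] [Group.FG G] (n : ℕ) (x : ℚ) :
    orbitSum G (Fin (n + 1)) x = ∑ k ∈ Finset.range (n + 1),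
      n.choose k * (x * (k.factorial * subgroupCount G (k + 1)) * orbitSum G (Fin (n - k)) x) := by
  classical
  let orb : (G →* Equiv.Perm (Fin (n + 1))) → Finset (Fin (n + 1)) := fun φ =>
    Finset.univ.filter fun a => ∃ g, φ g 0 = a
  have h0 : ∀ φ, (0 : Fin (n + 1)) ∈ orb φ := fun φ => by
    simp only [orb, Finset.mem_filter, Finset.mem_univ, true_and]
    exact ⟨1, by simp⟩
  have hfib : ∀ S : Finset (Fin (n + 1)), (0 : Fin (n + 1)) ∈ S →
      ∑ φ with orb φ = S, x ^ numOrbits φ =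
        x * ((S.card - 1).factorial * subgroupCount G S.card) *
          orbitSum G (Fin (n + 1 - S.card)) x := by
    intro S hS
    have e₁ : {a // a ∈ S} ≃ Fin (S.card - 1 + 1) := S.equivFinOfCardEq
      (Nat.sub_add_cancel (Finset.card_pos.2 ⟨0, hS⟩)).symm
    have e₂ : {a // ¬ a ∈ S} ≃ Fin (n + 1 - S.card) := Fintype.equivFinOfCardEq (by
      rw [Fintype.card_subtype_compl, Fintype.card_fin, Fintype.card_coe])
    have h := sum_unionHom (G := G) (p := fun a => a ∈ S) ⟨0, hS⟩ x
    rw [card_transitiveHom_congr e₁, card_transitiveHom, orbitSum_congr e₂,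
      Nat.sub_add_cancel (Finset.card_pos.2 ⟨0, hS⟩)] at h
    push_cast at h
    rw [← h]
    refine Finset.sum_subtype _ (fun φ => ?_) _
    simp [orb, Finset.ext_iff, eq_comm]
  rw [orbitSum, ← Finset.sum_fiberwise (s := Finset.univ) (g := orb)]
  -- Subsets containing $0$ correspond to subsets of the $n$ other points; those without $0$ are
  -- never orbits of $0$.
  have hu : (Finset.univ : Finset (Finset (Fin (n + 1)))) =
      (insert 0 (Finset.univ.erase (0 : Fin (n + 1)))).powerset := by
    rw [Finset.insert_erase (Finset.mem_univ _), Finset.powerset_univ]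
  rw [hu, Finset.sum_powerset_insert (Finset.notMem_erase _ _), Finset.sum_eq_zero, zero_add]
  · have hc : (Finset.univ.erase (0 : Fin (n + 1))).card = n := by simp
    have := Finset.sum_powerset_apply_card (fun k => x * (k.factorial * subgroupCount G (k + 1)) *
      orbitSum G (Fin (n - k)) x) (x := Finset.univ.erase (0 : Fin (n + 1)))
    rw [hc] at this
    simp only [nsmul_eq_mul] at this
    rw [← this]
    refine Finset.sum_congr rfl fun S hS => ?_
    have h0S : (0 : Fin (n + 1)) ∉ S := fun h =>
      Finset.notMem_erase _ _ (Finset.mem_powerset.1 hS h)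
    rw [hfib _ (Finset.mem_insert_self _ _), Finset.card_insert_of_notMem h0S,
      Nat.add_sub_cancel, Nat.add_sub_add_right]
  · intro S hS
    refine Finset.sum_eq_zero fun φ hφ => ?_
    obtain rfl := (Finset.mem_filter.1 hφ).2
    exact absurd (Finset.mem_powerset.1 hS (h0 φ)) (Finset.notMem_erase _ _)

end

noncomputable section

/-! ### Logarithmic derivatives of power series -/

section

open PowerSeries

/-- The equation $f'=af$ determines the coefficients successively: coefficient $n+1$ involves only
earlier ones and $a$ up to degree $n$. Agreement of $a$ and $b$ below $d$ thus suffices, which suits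
finite partial products. -/
lemma coeff_eq_of_derivative_eq {f h a b : ℚ⟦X⟧} (hf : d⁄dX ℚ f = a * f) (hh : d⁄dX ℚ h = b * h)
    (h0 : coeff 0 f = coeff 0 h) {d : ℕ} (hab : ∀ j < d, coeff j a = coeff j b) :
    ∀ n ≤ d, coeff n f = coeff n h := by
  intro n
  induction n using Nat.strong_induction_on with
  | _ n ih =>
    intro hn
    rcases n with _ | n
    · exact h0
    · have h1 : coeff (n + 1) f * (n + 1 : ℚ) = coeff (n + 1) h * (n + 1 : ℚ) := by
        rw [← coeff_derivative, ← coeff_derivative, hf, hh, coeff_mul, coeff_mul]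
        refine Finset.sum_congr rfl fun p hp => ?_
        have := Finset.HasAntidiagonal.mem_antidiagonal.1 hp
        rw [hab _ (by omega), ih _ (by omega) (by omega)]
      exact mul_right_cancel₀ (by positivity) h1

lemma derivative_prod {ι : Type*} (F a : ι → ℚ⟦X⟧) (h : ∀ i, d⁄dX ℚ (F i) = a i * F i)
    (s : Finset ι) : d⁄dX ℚ (∏ i ∈ s, F i) = (∑ i ∈ s, a i) * ∏ i ∈ s, F i := by
  classical
  induction s using Finset.induction_on with
  | empty => simp
  | insert i s hi ih =>
    rw [Finset.prod_insert hi, Finset.sum_insert hi, Derivation.leibniz, ih, h, smul_eq_mul,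
      smul_eq_mul]
    ring

lemma constantCoeff_seriesZPow {f : ℚ⟦X⟧} (hf : constantCoeff f = 1) (k : ℤ) :
    constantCoeff (seriesZPow f k) = 1 := by
  cases k with
  | ofNat k => simp [seriesZPow, hf]
  | negSucc k => simp [seriesZPow, hf]

lemma derivative_pow_of_eq {f a : ℚ⟦X⟧} (h : d⁄dX ℚ f = a * f) (k : ℕ) :
    d⁄dX ℚ (f ^ k) = (k : ℚ⟦X⟧) * a * f ^ k := by
  have := derivative_prod (fun _ : Fin k => f) (fun _ => a) (fun _ => h) Finset.univ
  simpa using this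

lemma derivative_seriesZPow {f a : ℚ⟦X⟧} (h : d⁄dX ℚ f = a * f) (hf : constantCoeff f = 1) (k : ℤ) :
    d⁄dX ℚ (seriesZPow f k) = (k : ℚ⟦X⟧) * a * seriesZPow f k := by
  cases k with
  | ofNat k => simpa [seriesZPow] using derivative_pow_of_eq h k
  | negSucc k =>
    have hinv : d⁄dX ℚ f⁻¹ = -a * f⁻¹ := by
      have hm : f⁻¹ * f = 1 := PowerSeries.inv_mul_cancel f (by simp [hf])
      rw [derivative_inv', h]
      linear_combination (-a * f⁻¹) * hm
    have := derivative_pow_of_eq hinv (k + 1)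
    rw [seriesZPow, this, Int.cast_negSucc]
    ring

/-- The series `u ^ (N - 1) / (1 - u ^ N)`. -/
def dvdSeries (N : ℕ) : ℚ⟦X⟧ :=
  mk fun k => if N ∣ k + 1 then 1 else 0

lemma dvdSeries_mul {N : ℕ} (hN : 0 < N) : dvdSeries N * (1 - X ^ N) = X ^ (N - 1) := by
  ext k
  rw [mul_sub, mul_one, map_sub, coeff_mul_X_pow', coeff_X_pow, dvdSeries, coeff_mk]
  by_cases hk : N ≤ k
  · have h1 : N ∣ k + 1 ↔ N ∣ k - N + 1 := by
      rw [show k + 1 = (k - N + 1) + N by omega, Nat.dvd_add_left (dvd_refl N)]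
    rw [if_pos hk, coeff_mk, if_neg (show ¬ k = N - 1 by omega)]
    simp only [h1, sub_self]
  · rw [if_neg hk, sub_zero]
    refine if_congr ⟨fun h => ?_, ?_⟩ rfl rfl
    · have := Nat.le_of_dvd k.succ_pos h
      omega
    · rintro rfl
      rw [Nat.sub_add_cancel hN]

lemma derivative_one_sub_X_pow {N : ℕ} (hN : 0 < N) :
    d⁄dX ℚ (1 - (X : ℚ⟦X⟧) ^ N) = (-(N : ℚ⟦X⟧) * dvdSeries N) * (1 - X ^ N) := by
  rw [mul_assoc, dvdSeries_mul hN, map_sub, Derivation.map_one_eq_zero, Derivation.leibniz_pow,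
    derivative_X]
  simp

end

/-! ### The generating function of the actions on finite sets -/

section

open PowerSeries

variable (G : Type*) [Group G] [Group.FG G]

/-- The exponential generating function of the numbers `orbitSum G (Fin n) x`. -/
def orbitSeries (x : ℚ) : ℚ⟦X⟧ :=
  mk fun n => orbitSum G (Fin n) x / n.factorial

lemma constantCoeff_orbitSeries (x : ℚ) : constantCoeff (orbitSeries G x) = 1 := by
  have h : ∀ φ : G →* Equiv.Perm (Fin 0), numOrbits φ = 0 := fun φ => by
    rw [numOrbits, Nat.card_eq_zero]
    exact Or.inl ⟨fun q => by
      obtain ⟨a, -⟩ := Quotient.exists_rep q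
      exact a.elim0⟩
  have : Subsingleton (G →* Equiv.Perm (Fin 0)) :=
    ⟨fun φ ψ => MonoidHom.ext fun g => Subsingleton.elim _ _⟩
  rw [← coeff_zero_eq_constantCoeff_apply, orbitSeries, coeff_mk, orbitSum]
  simp only [h, pow_zero, Finset.sum_const, Finset.card_univ]
  rw [Fintype.card_eq_one_iff.2 ⟨1, fun φ => Subsingleton.elim _ _⟩]
  simp

/-- The generating function of the numbers of subgroups. -/
def subgroupSeries : ℚ⟦X⟧ :=
  mk fun k => (subgroupCount G (k + 1) : ℚ)

/-- This is `orbitSum_succ` divided by $n!$: the binomial coefficient and $k!$ leave $1/(n-k)!$. -/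
lemma derivative_orbitSeries (x : ℚ) :
    d⁄dX ℚ (orbitSeries G x) = (C x * subgroupSeries G) * orbitSeries G x := by
  ext n
  rw [coeff_derivative, coeff_mul, Finset.Nat.sum_antidiagonal_eq_sum_range_succ_mk, orbitSeries,
    coeff_mk, orbitSum_succ, Nat.factorial_succ, div_mul_eq_mul_div, Finset.sum_mul,
    Finset.sum_div]
  refine Finset.sum_congr rfl fun k hk => ?_
  have hk : k ≤ n := Nat.lt_succ_iff.1 (Finset.mem_range.1 hk)
  rw [coeff_C_mul, subgroupSeries, coeff_mk, coeff_mk]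
  have h1 : (n.choose k : ℚ) * k.factorial * (n - k).factorial = n.factorial := by
    exact_mod_cast Nat.choose_mul_factorial_mul_factorial hk
  have h2 : ((n - k).factorial : ℚ) ≠ 0 := by positivity
  have h3 : (n.factorial : ℚ) ≠ 0 := by positivity
  push_cast
  rw [← h1] at h3 ⊢
  have h4 : (n : ℚ) + 1 ≠ 0 := by positivity
  have h5 : (k.factorial : ℚ) ≠ 0 := by positivity
  have h6 : (n.choose k : ℚ) ≠ 0 := by
    exact_mod_cast (Nat.choose_pos hk).ne'
  field_simp

/-- Both sides have constant term $1$ and logarithmic derivative $k$ times that of the series at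
$1$. -/
lemma orbitSeries_intCast (k : ℤ) :
    orbitSeries G (k : ℚ) = seriesZPow (orbitSeries G 1) k := by
  have h1 := constantCoeff_orbitSeries G 1
  ext n
  refine coeff_eq_of_derivative_eq (derivative_orbitSeries G k)
    (derivative_seriesZPow (derivative_orbitSeries G 1) h1 k) ?_ (d := n) (fun j _ => ?_) n le_rfl
  · rw [coeff_zero_eq_constantCoeff_apply, coeff_zero_eq_constantCoeff_apply,
      constantCoeff_orbitSeries, constantCoeff_seriesZPow h1]
  · rw [map_one, one_mul, map_intCast]

end

/-! ### The product formula -/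

/-- Group the tuples by their product $e\mid n$; all factorizations of $e\le d$ lie in $s$, so each
group gives $e\,s_e(\mathbf{Z}^k)$. -/
lemma sum_dvd_eq_subgroupCount {k d : ℕ} {s : Finset (Fin k → ℕ+)}
    (hs : ∀ n, n ≠ 0 → n ≤ d → factorizations k n ⊆ s) {n : ℕ} (hn : n ≠ 0) (hnd : n ≤ d) :
    ∑ i ∈ s with (∏ j, (i j : ℕ)) ∣ n, (∏ j, (i j : ℕ)) * tupleWeight i =
      subgroupCount (IntPow (k + 1)) n := by
  classical
  rw [subgroupCount_intPow_succ k hn, ← Finset.sum_fiberwise_of_maps_to (t := n.divisors)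
    (g := fun i : Fin k → ℕ+ => ∏ j, (i j : ℕ))
    (fun i hi => Nat.mem_divisors.2 ⟨(Finset.mem_filter.1 hi).2, hn⟩)]
  refine Finset.sum_congr rfl fun e he => ?_
  have he0 := (Nat.pos_of_mem_divisors he).ne'
  rw [subgroupCount_intPow k he0, Finset.mul_sum]
  refine Finset.sum_congr ?_ fun i hi => by rw [(mem_factorizations he0 i).1 hi]
  ext i
  rw [Finset.mem_filter, Finset.mem_filter, mem_factorizations he0]
  constructor
  · exact fun h => h.2
  · rintro h
    refine ⟨⟨hs e he0 ((Nat.divisor_le he).trans hnd) ((mem_factorizations he0 i).2 h), ?_⟩, h⟩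
    rw [h]
    exact Nat.dvd_of_mem_divisors he

open PowerSeries in
-- A factor with $N=\prod_j i_j$ and weight $w$ has logarithmic derivative $cwN\,u^{N-1}/(1-u^N)$;
-- these sum to $c$ times the subgroup series below degree $d$.
lemma hasFormalProd_orbitSeries (k : ℕ) (c : ℤ) :
    HasFormalProd (fun i : Fin k → ℕ+ =>
        seriesZPow (1 - (PowerSeries.X : ℚ⟦X⟧) ^ (∏ j, (i j : ℕ))) (-(c * tupleWeight i)))
      (orbitSeries (IntPow (k + 1)) c) := by
  classical
  intro d
  -- Tuples with product above $d$ do not affect degrees up to $d$, so containing all factorizations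
  -- of numbers up to $d$ is enough.
  filter_upwards [Filter.eventually_ge_atTop
    ((Finset.range (d + 1)).biUnion fun n => factorizations k n)] with s hs
  have hs' : ∀ n, n ≠ 0 → n ≤ d → factorizations k n ⊆ s := fun n _ hn =>
    (Finset.subset_biUnion_of_mem (fun n => factorizations k n)
      (Finset.mem_range.2 (Nat.lt_succ_of_le hn))).trans hs
  have hpos : ∀ i : Fin k → ℕ+, 0 < ∏ j, (i j : ℕ) := fun i =>
    Finset.prod_pos fun j _ => (i j).pos
  have hcc : ∀ i : Fin k → ℕ+,
      constantCoeff (1 - (PowerSeries.X : ℚ⟦X⟧) ^ (∏ j, (i j : ℕ))) = 1 := fun i => by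
    rw [map_sub, map_pow, constantCoeff_X, zero_pow (hpos i).ne', map_one, sub_zero]
  refine coeff_eq_of_derivative_eq (derivative_prod _ _ (fun i => derivative_seriesZPow
    (derivative_one_sub_X_pow (hpos i)) (hcc i) _) s) (derivative_orbitSeries _ _) ?_
    (d := d) (fun n hn => ?_) d le_rfl
  · rw [coeff_zero_eq_constantCoeff_apply, coeff_zero_eq_constantCoeff_apply,
      constantCoeff_orbitSeries, map_prod]
    exact Finset.prod_eq_one fun i _ => constantCoeff_seriesZPow (hcc i) _
  -- Coefficient $n$ counts subgroups of index $n+1$, and $n<d$ keeps that index within the range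
  -- covered by $s$.
  · rw [coeff_C_mul, subgroupSeries, coeff_mk,
      ← sum_dvd_eq_subgroupCount hs' n.succ_ne_zero hn, map_sum, Finset.sum_filter, Nat.cast_sum,
      Finset.mul_sum]
    refine Finset.sum_congr rfl fun i _ => ?_
    have : ((-(c * (tupleWeight i : ℤ)) : ℤ) : ℚ⟦X⟧) *
        (-((∏ j, (i j : ℕ) : ℕ) : ℚ⟦X⟧) * dvdSeries (∏ j, (i j : ℕ))) =
        C ((c : ℚ) * ((∏ j, (i j : ℕ) : ℕ) * tupleWeight i : ℚ)) *
          dvdSeries (∏ j, (i j : ℕ)) := by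
      rw [map_mul, map_mul, map_intCast, map_natCast, map_natCast]
      push_cast
      ring
    rw [this, coeff_C_mul, dvdSeries, coeff_mk]
    split_ifs
    · push_cast
      ring
    · simp

/-! ### Products of a space -/

lemma orbifoldGeneratingFunction_eq {M : Type u} [TopologicalSpace M]
    (hM : HasFiniteRationalHomology M) (m : ℕ) :
    orbifoldGeneratingFunction M m = PowerSeries.mk fun n => (1 / (n.factorial : ℚ)) *
        ∑ π ∈ commutingTuples (Equiv.Perm (Fin n)) m,
          (eulerCharacteristic M : ℚ) ^ numComponents π := by
  obtain ⟨p, hp⟩ := (hasFiniteRationalHomology_iff M).1 hM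
  rw [orbifoldGeneratingFunction]
  congr 1
  funext n
  rw [orbifoldEulerCharacteristic, Fintype.card_perm, Fintype.card_fin]
  congr 1
  refine Finset.sum_congr rfl fun π _ => ?_
  rw [(hp.fixedPoints π).eulerCharacteristic_eq, hp.eulerCharacteristic_eq, Polynomial.eval₂_pow,
    Int.cast_pow]

lemma mk_sum_commutingTuples (m : ℕ) (x : ℚ) :
    (PowerSeries.mk fun n => (1 / (n.factorial : ℚ)) *
      ∑ π ∈ commutingTuples (Equiv.Perm (Fin n)) m, x ^ numComponents π) =
    orbitSeries (IntPow m) x := by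
  rw [orbitSeries]
  congr 1
  funext n
  rw [sum_commutingTuples, one_div_mul_eq_div]

lemma mk_card_commutingTuples (m : ℕ) :
    (PowerSeries.mk fun n =>
      ((commutingTuples (Equiv.Perm (Fin n)) m).card : ℚ) / (n.factorial : ℚ)) =
    orbitSeries (IntPow m) 1 := by
  rw [← mk_sum_commutingTuples]
  congr 1
  funext n
  simp [div_eq_inv_mul]

theorem theorem1
    {E : Type*} [NormedAddCommGroup E] [NormedSpace ℝ E] [FiniteDimensional ℝ E]
    {H : Type*} [TopologicalSpace H] (_I : ModelWithCorners ℝ E H)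
    (M : Type u) [TopologicalSpace M] [T2Space M] [SecondCountableTopology M] [ChartedSpace H M]
    (hM : HasFiniteRationalHomology M) (m : ℕ) (hm : 1 ≤ m) :
    -- all the Euler characteristics in the definition of `χ_m(M^n, S_n)` are defined
    (∀ n : ℕ, ∀ π ∈ commutingTuples (Equiv.Perm (Fin n)) m,
      HasFiniteRationalHomology (simultaneousFixedPoints (Fin n → M) π)) ∧
    orbifoldGeneratingFunction M m =
      PowerSeries.mk (fun n : ℕ => (1 / (n.factorial : ℚ)) *
        ∑ π ∈ commutingTuples (Equiv.Perm (Fin n)) m,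
          (eulerCharacteristic M : ℚ) ^ numComponents π) ∧
    orbifoldGeneratingFunction M m =
      seriesZPow
        (PowerSeries.mk fun n : ℕ =>
          ((commutingTuples (Equiv.Perm (Fin n)) m).card : ℚ) / (n.factorial : ℚ))
        (eulerCharacteristic M) ∧
    -- the index `j : Fin (m - 1)` stands for `j + 1`, so `m - 2 - j` is the exponent of `i_{j+1}`
    HasFormalProd
      (fun i : Fin (m - 1) → ℕ+ =>
        seriesZPow (1 - (PowerSeries.X : ℚ⟦X⟧) ^ (∏ j, (i j : ℕ)))
          (-(eulerCharacteristic M * ∏ j, ((i j : ℕ) : ℤ) ^ (m - 2 - (j : ℕ)))))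
      (orbifoldGeneratingFunction M m) := by
  have hgen := orbifoldGeneratingFunction_eq hM m
  refine ⟨fun n π _ => ?_, hgen, ?_, ?_⟩
  · obtain ⟨p, hp⟩ := (hasFiniteRationalHomology_iff M).1 hM
    exact (hasFiniteRationalHomology_iff _).2 ⟨_, hp.fixedPoints π⟩
  · rw [hgen, mk_sum_commutingTuples, mk_card_commutingTuples, orbitSeries_intCast]
  -- With $m=k+1$ the exponents $m-2-j$ become the $k-1-j$ of `tupleWeight`; for $k=0$ the only
  -- tuple is empty, with product $1$.
  · obtain ⟨k, rfl⟩ := Nat.exists_eq_add_of_le' hm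
    rw [hgen, mk_sum_commutingTuples]
    have h := hasFormalProd_orbitSeries k (eulerCharacteristic M)
    simp only [tupleWeight, Nat.cast_prod, Nat.cast_pow] at h
    exact h

end
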